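/- Let $PID^*$ be a finite set of process identifiers, $PID=PID^*\cup\{NULL\}$, and let $users\subseteq PID^*$ have $N$ elements, $1\le N\le 4$. Let $max\ge N$ be a queue capacity. Then in the failures-divergences model of CSP $$SPEC \sqsubseteq_{FD} IMPL \quad\text{and}\quad IMPL \sqsubseteq_{FD} SPEC .$$ Here $P\sqsubseteq_{FD}Q$ means $failures_\bot(Q)\subseteq failures_\bot(P)$ and $divergences(Q)\subseteq divergences(P)$, where $failures_\bot(P)=failures(P)\cup\{(s,X)\mid s\in divergences(P)\}$ and all these sets are given by the standard operational semantics of CSP. Below, $\Box$ is external choice, $|||$ interleaving, $\|_A$ parallel composition synchronising on $A$, $\setminus$ hiding, $b\,\&\,P$ is $P$ if $b$ holds and $STOP$ otherwise, $c?x$ ranges over all values of the channel's type, and $\{|c|\}$ is the set of all events of channel $c$. The letters $p,pid,id,proc$ range over $PID^*$, process states over $\{WAITING,ENGAGING,SCHEDULED,ACTIVE\}$. **Specification.** $SPEC=\bigl((|||_{u\in users} U(u))\ \|_{\Sigma}\ MUTEX(NULL)\bigr)\setminus\{|lin\_claim,lin\_release|\}$, where $\Sigma$ consists of all events on $begin\_claim,lin\_claim,end\_claim,begin\_release,lin\_release,end\_release$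 and - $U(p)=begin\_claim.p\to lin\_claim.p\to end\_claim.p\to begin\_release.p\to lin\_release.p\to end\_release.p\to U(p)$; - $MUTEX(u)=begin\_claim?\_\to MUTEX(u)\ \Box\ u=NULL\,\&\,lin\_claim?p\to MUTEX(p)$ (with $p\in users$) $\Box\ u\ne NULL\,\&\,end\_claim.u\to MUTEX(u)\ \Box\ u\neq NULL\,\&\,begin\_release.u\to MUTEX(u)\ \Box\ u\ne NULL\,\&\,lin\_release.u\to MUTEX(NULL)\ \Box\ end\_release?\_\to MUTEX(u)$. **Implementation.** $IMPL=\Bigl(\bigl(QUEUE\,|||\,STATE\_VAR\,|||\,OWNER\bigr)\ \|_{DATA}\ (|||_{u\in users} USER(u))\Bigr)\setminus DATA$, where $USER(p)=CLAIM(p);RELEASE(p);USER(p)$ and $DATA$ is the set of all events on the channels $getOwner,setOwner,casOwner,getState,setState,casState,enqueue,end\_enqueue,dequeue,peek,return$. *Variables.* $AV(get,set,cas,v)=get!v\to AV(\ldots,v)\ \Box\ set?w\to AV(\ldots,w)\ \Box\ cas?e?w!(e=v)\to(\text{if }e=v\text{ then }AV(\ldots,w)\text{ else }AV(\ldots,v))$;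 $OWNER=AV(getOwner,setOwner,casOwner,NULL)$ with values in $PID$; $STATE\_VAR=|||_{p\in PID^*}AV(getState.p,setState.p,casState.p,ACTIVE)$. *Queue.* $QUEUE=\bigl((|||_{id\in users}QU(id))\ \|_{SYNC}\ QS(\langle\rangle)\bigr)\setminus\{|lin\_enqueue,lin\_dequeue,lin\_peek|\}$, where $SYNC$ is the set of all events on $enqueue,dequeue,peek,end\_enqueue,return,lin\_enqueue,lin\_dequeue,lin\_peek$; - $QU(id)=enqueue.id?v\to lin\_enqueue.id.v\to end\_enqueue.id\to QU(id)\ \Box\ dequeue.id\to lin\_dequeue.id?v\to return.id.v\to QU(id)\ \Box\ peek.id\to lin\_peek.id?v\to return.id.v\to QU(id)$; - $QS(q)$, guarded by $length(q)\le max$, offers every event on $enqueue,end\_enqueue,dequeue,peek,return$ (each continuing as $QS(q)$), $lin\_enqueue?proc?v\to QS(q^\frown\langle v\rangle)$, and for every $proc$: if $q=\langle\rangle$, $lin\_dequeue.proc.NULL\to QS(q)$ and $lin\_peek.proc.NULL\to QS(q)$; otherwise $lin\_dequeue.proc.head(q)\to QS(tail(q))$ and $lin\_peek.proc.head(q)\to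 QS(q)$. *Abbreviations.* - $DONE(p)=setState.p!ACTIVE\to end\_claim.p\to SKIP$; - $YIELD(p)=getState.p.SCHEDULED\to setState.p.ACTIVE\to SKIP$; - $WAIT(p)=casState.p!ENGAGING!WAITING?s\to(\text{if }s\text{ then }YIELD(p);\,end\_claim.p\to SKIP\text{ else }DONE(p))$; - $SCHEDULE(p)=casState.p!ENGAGING!SCHEDULED?s\to(\text{if }\neg s\text{ then }casState.p!WAITING!SCHEDULED?\_\to SKIP\text{ else }SKIP)$. *Claim.* $CLAIM(p)=begin\_claim.p\to setState.p.ENGAGING\to enqueue.p.p\to end\_enqueue.p\to peek.p\to return.p?h\to C$, where $C$ is $WAIT(p)$ if $h\ne p$, and for $h=p$ it is $casOwner!NULL!p?s\to$ (if $s$ then $DONE(p)$ else $getOwner?o\to C'$). Here $C'$ is - $setOwner!p\to DONE(p)$ if $o=NULL$; - $WAIT(p)$ if $o=p$; - otherwise $casOwner!o!p?s\to$ (if $s$ then $DONE(p)$ else $casOwner!NULL!p?s'\to$ (if $s'$ then $DONE(p)$ else $WAIT(p)$)). *Release.* $RELEASE(p)=begin\_release.p\to dequeue.p\to return.p.p\to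 peek.p\to return.p?h\to R$, where $R$ is - $casOwner!p!NULL?\_\to end\_release.p\to SKIP$ if $h=NULL$; - otherwise $casOwner!p!h?s\to$ (if $s$ then $SCHEDULE(h);\,end\_release.p\to SKIP$ else $end\_release.p\to SKIP$). -/

import Mathlib

/-! ## Communicating sequential processes -/

namespace CSP

/-- Visible actions: events of the alphabet `E`, and the termination signal `✓` (`tick`). -/
inductive Obs (E : Type) : Type
  | ev (e : E)
  | tick

/-- Transition labels: the internal action `τ`, or a visible action. -/
inductive Label (E : Type) : Type
  | tau
  | vis (o : Obs E)

/-- CSP process terms over an alphabet `E`, with process names (for recursion) in `K`. -/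
inductive Proc (E K : Type) : Type 1
  /-- the deadlocked process `STOP` -/
  | dead
  /-- the process `SKIP`, which terminates successfully -/
  | skip
  /-- `Ω`, the state reached after successful termination -/
  | omega
  /-- prefix choice `c?x → P(x)`; the parameter `x` ranges over all of `α` -/
  | input {α : Type} (c : α → E) (P : α → Proc E K)
  /-- external choice `P □ Q` -/
  | extChoice (P Q : Proc E K)
  /-- sequential composition `P ; Q` -/
  | seq (P Q : Proc E K)
  /-- generalised parallel: `P` and `Q` synchronise exactly on the events in `A` -/
  | par (A : Set E) (P Q : Proc E K)
  /-- replicated interleaving `||| i • P i` -/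
  | interleave {ι : Type} (P : ι → Proc E K)
  /-- hiding `P \ A` -/
  | hide (P : Proc E K) (A : Set E)
  /-- the process named `k` -/
  | call (k : K)

namespace Proc

variable {E K : Type}

/-- The prefix process `e → P`. -/
def pre (e : E) (P : Proc E K) : Proc E K := input (fun _ : Unit => e) (fun _ => P)

/-- The guarded process `b & P`. -/
def guarded (b : Prop) [Decidable b] (P : Proc E K) : Proc E K := if b then P else dead

end Proc

infixr:65 " ⟿ " => Proc.pre
infixr:60 " ◻ " => Proc.extChoice
infixr:62 " ⨾ " => Proc.seq

/-- Structural operational semantics, relative to the defining equations `k = defs k` of the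
process names. A name has exactly the transitions of its definition (as in all the systems below,
definitions are understood to be guarded: recursive calls occur behind a prefix). -/
inductive Step {E K : Type} (defs : K → Proc E K) : Proc E K → Label E → Proc E K → Prop
  | skip : Step defs .skip (.vis .tick) .omega
  | input {α : Type} (c : α → E) (P : α → Proc E K) (x : α) :
      Step defs (.input c P) (.vis (.ev (c x))) (P x)
  | ext_left {P P' Q : Proc E K} {o : Obs E} :
      Step defs P (.vis o) P' → Step defs (.extChoice P Q) (.vis o) P'
  | ext_right {P Q Q' : Proc E K} {o : Obs E} :
      Step defs Q (.vis o) Q' → Step defs (.extChoice P Q) (.vis o) Q'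
  | ext_tau_left {P P' Q : Proc E K} :
      Step defs P .tau P' → Step defs (.extChoice P Q) .tau (.extChoice P' Q)
  | ext_tau_right {P Q Q' : Proc E K} :
      Step defs Q .tau Q' → Step defs (.extChoice P Q) .tau (.extChoice P Q')
  | seq_left {P P' Q : Proc E K} {l : Label E} :
      l ≠ .vis .tick → Step defs P l P' → Step defs (.seq P Q) l (.seq P' Q)
  | seq_tick {P P' Q : Proc E K} :
      Step defs P (.vis .tick) P' → Step defs (.seq P Q) .tau Q
  | par_tau_left {A : Set E} {P P' Q : Proc E K} :
      Step defs P .tau P' → Step defs (.par A P Q) .tau (.par A P' Q)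
  | par_tau_right {A : Set E} {P Q Q' : Proc E K} :
      Step defs Q .tau Q' → Step defs (.par A P Q) .tau (.par A P Q')
  | par_left {A : Set E} {P P' Q : Proc E K} {e : E} :
      e ∉ A → Step defs P (.vis (.ev e)) P' →
        Step defs (.par A P Q) (.vis (.ev e)) (.par A P' Q)
  | par_right {A : Set E} {P Q Q' : Proc E K} {e : E} :
      e ∉ A → Step defs Q (.vis (.ev e)) Q' →
        Step defs (.par A P Q) (.vis (.ev e)) (.par A P Q')
  | par_sync {A : Set E} {P P' Q Q' : Proc E K} {e : E} :
      e ∈ A → Step defs P (.vis (.ev e)) P' → Step defs Q (.vis (.ev e)) Q' →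
        Step defs (.par A P Q) (.vis (.ev e)) (.par A P' Q')
  | par_tick_left {A : Set E} {P P' Q : Proc E K} :
      Step defs P (.vis .tick) P' → Step defs (.par A P Q) .tau (.par A .omega Q)
  | par_tick_right {A : Set E} {P Q Q' : Proc E K} :
      Step defs Q (.vis .tick) Q' → Step defs (.par A P Q) .tau (.par A P .omega)
  | par_tick {A : Set E} :
      Step defs (.par A .omega .omega) (.vis .tick) .omega
  | interleave_step {ι : Type} {P P' : ι → Proc E K} {l : Label E} (i : ι) :
      l ≠ .vis .tick → Step defs (P i) l (P' i) → (∀ j, j ≠ i → P' j = P j) →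
        Step defs (.interleave P) l (.interleave P')
  | interleave_tick_one {ι : Type} {P P' : ι → Proc E K} {R : Proc E K} (i : ι) :
      Step defs (P i) (.vis .tick) R → P' i = .omega → (∀ j, j ≠ i → P' j = P j) →
        Step defs (.interleave P) .tau (.interleave P')
  | interleave_tick {ι : Type} {P : ι → Proc E K} :
      (∀ i, P i = .omega) → Step defs (.interleave P) (.vis .tick) .omega
  | hide_tau {P P' : Proc E K} {A : Set E} :
      Step defs P .tau P' → Step defs (.hide P A) .tau (.hide P' A)
  | hide_hidden {P P' : Proc E K} {A : Set E} {e : E} :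
      e ∈ A → Step defs P (.vis (.ev e)) P' → Step defs (.hide P A) .tau (.hide P' A)
  | hide_visible {P P' : Proc E K} {A : Set E} {e : E} :
      e ∉ A → Step defs P (.vis (.ev e)) P' →
        Step defs (.hide P A) (.vis (.ev e)) (.hide P' A)
  | hide_tick {P P' : Proc E K} {A : Set E} :
      Step defs P (.vis .tick) P' → Step defs (.hide P A) (.vis .tick) .omega
  | call {k : K} {l : Label E} {P' : Proc E K} :
      Step defs (defs k) l P' → Step defs (.call k) l P'

section Semantics

variable {E K : Type} (defs : K → Proc E K)

/-- `Runs defs P s Q`: `P` can evolve to `Q` while performing the trace `s` of visible actions,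
interspersed with arbitrarily many internal actions. -/
inductive Runs : Proc E K → List (Obs E) → Proc E K → Prop
  | nil (P : Proc E K) : Runs P [] P
  | tau {P P' Q : Proc E K} {s : List (Obs E)} :
      Step defs P .tau P' → Runs P' s Q → Runs P s Q
  | vis {P P' Q : Proc E K} {o : Obs E} {s : List (Obs E)} :
      Step defs P (.vis o) P' → Runs P' s Q → Runs P (o :: s) Q

/-- A stable state is one without internal actions. -/
def Stable (P : Proc E K) : Prop := ∀ P', ¬ Step defs P .tau P'

/-- `P` can perform an infinite sequence of internal actions. -/
def Diverges (P : Proc E K) : Prop :=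
  ∃ f : ℕ → Proc E K, f 0 = P ∧ ∀ n, Step defs (f n) .tau (f (n + 1))

/-- The state `P` refuses the set `X`: it is stable and can perform no member of `X`, or it can
terminate and `X` does not contain `✓`. -/
def Refuses (P : Proc E K) (X : Set (Obs E)) : Prop :=
  (Stable defs P ∧ ∀ o ∈ X, ∀ P', ¬ Step defs P (.vis o) P') ∨
    ((∃ P', Step defs P (.vis .tick) P') ∧ Obs.tick ∉ X)

/-- The stable failures of a process. -/
def failures (P : Proc E K) : Set (List (Obs E) × Set (Obs E)) :=
  {f | ∃ Q, Runs defs P f.1 Q ∧ Refuses defs Q f.2}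

/-- The divergences of a process: the traces (with `✓` at most at the end) that extend a trace
after which the process can diverge. -/
def divergences (P : Proc E K) : Set (List (Obs E)) :=
  {u | Obs.tick ∉ u.dropLast ∧
    ∃ s Q, s <+: u ∧ Obs.tick ∉ s ∧ Runs defs P s Q ∧ Diverges defs Q}

/-- The failures of a process, extended by all failures on its divergences. -/
def failuresBot (P : Proc E K) : Set (List (Obs E) × Set (Obs E)) :=
  failures defs P ∪ {f | f.1 ∈ divergences defs P}

/-- Refinement `P ⊑_FD Q` in the failures-divergences model (`P` is the specification). -/
def FDRefines (P Q : Proc E K) : Prop :=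
  failuresBot defs Q ⊆ failuresBot defs P ∧ divergences defs Q ⊆ divergences defs P

end Semantics

end CSP

/-! ## The claim/release protocol and its mutex specification -/

namespace ClaimRelease

open CSP

/-- The two operations on a variable. -/
inductive Operation : Type
  | load
  | store

/-- The possible states of a user process. -/
inductive UState : Type
  | waiting
  | engaging
  | scheduled
  | active
  deriving DecidableEq

/-- The events. The type `P` is that of the non-null process identifiers; an identifier that may
be `NULL` is an element of `Option P`, with `NULL = none`. -/
inductive Event (P : Type) : Type
  | owner (op : Operation) (v : Option P)
  | ownerCas (expected newVal : Option P) (succ : Bool)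
  | state (op : Operation) (p : P) (s : UState)
  | casState (p : P) (expected newVal : UState) (succ : Bool)
  | enqueue (p v : P)
  | endEnqueue (p : P)
  | dequeue (p : P)
  | peek (p : P)
  | ret (p : P) (v : Option P)
  | linEnqueue (p v : P)
  | linDequeue (p : P) (v : Option P)
  | linPeek (p : P) (v : Option P)
  | beginClaim (p : P)
  | endClaim (p : P)
  | beginRelease (p : P)
  | endRelease (p : P)
  | linClaim (p : P)
  | linRelease (p : P)

/-- The names of the recursive processes. -/
inductive Name (P : Type) : Type
  /-- the variable `OWNER`, with its current value -/
  | ownerVar (v : Option P)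
  /-- the state variable of a process identifier, with its current value -/
  | stateVar (p : P) (s : UState)
  /-- `USER` of the queue -/
  | queueUser (p : P)
  /-- `QUEUE_SPEC`, with the current content of the queue -/
  | queueSpec (q : List P)
  /-- `USER` of the implementation -/
  | implUser (p : P)
  /-- `USER` of the mutex specification -/
  | specUser (p : P)
  /-- `MUTEX_SPEC`, with the current owner -/
  | mutexSpec (user : Option P)

/-- Process terms over the events and the names above. -/
abbrev Term (P : Type) : Type 1 := Proc (Event P) (Name P)

section Model

variable {P : Type} [DecidableEq P]

/-! ### Shared variables -/

/-- The body of `ATOMIC_VARIABLE(get, set, cas, val)`; `self v` is the recursive call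
`ATOMIC_VARIABLE(get, set, cas, v)`. -/
def atomicVariable {V : Type} [DecidableEq V] (get set : V → Event P)
    (cas : V → V → Bool → Event P) (self : V → Term P) (val : V) : Term P :=
  (get val ⟿ self val)
  ◻ .input (fun newVal : V => set newVal) (fun newVal => self newVal)
  ◻ .input (fun x : V × V => cas x.1 x.2 (decide (x.1 = val)))
      (fun x => if x.1 = val then self x.2 else self val)

/-- `OWNER`. -/
def owner : Term P := .call (.ownerVar none)

/-- `STATE_VAR`. -/
def stateVar : Term P := .interleave (fun p : P => .call (.stateVar p .active))

/-! ### Scheduling -/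

/-- `YIELD(pid)`. -/
def yieldProc (pid : P) : Term P :=
  Event.state .load pid .scheduled ⟿ Event.state .store pid .active ⟿ .skip

/-- `SCHEDULE(pid)`. -/
def schedule (pid : P) : Term P :=
  .input (fun succ : Bool => Event.casState pid .engaging .scheduled succ) (fun succ =>
    if ¬ succ then
      .input (fun b : Bool => Event.casState pid .waiting .scheduled b) (fun _ => .skip)
    else .skip)

/-! ### The concurrent queue -/

/-- The body of `USER(id)` of the queue. -/
def queueUserBody (id : P) : Term P :=
  .input (fun val : P => Event.enqueue id val) (fun val =>
      Event.linEnqueue id val ⟿ Event.endEnqueue id ⟿ .call (.queueUser id))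
  ◻ (Event.dequeue id ⟿ .input (fun val : Option P => Event.linDequeue id val) (fun val =>
      Event.ret id val ⟿ .call (.queueUser id)))
  ◻ (Event.peek id ⟿ .input (fun val : Option P => Event.linPeek id val) (fun val =>
      Event.ret id val ⟿ .call (.queueUser id)))

/-- The body of `QUEUE_SPEC(q)`, for the maximal length `max`. -/
def queueSpecBody (max : ℕ) (q : List P) : Term P :=
  .guarded (q.length ≤ max) (
    .input (fun x : P × P => Event.enqueue x.1 x.2) (fun _ => .call (.queueSpec q))
    ◻ .input (fun x : P × P => Event.linEnqueue x.1 x.2)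
        (fun x => .call (.queueSpec (q ++ [x.2])))
    ◻ .input (fun p : P => Event.endEnqueue p) (fun _ => .call (.queueSpec q))
    ◻ .input (fun p : P => Event.dequeue p) (fun _ => .call (.queueSpec q))
    ◻ (match q with
        | [] => .input (fun p : P => Event.linDequeue p none) (fun _ => .call (.queueSpec []))
        | h :: t =>
            .input (fun p : P => Event.linDequeue p (some h)) (fun _ => .call (.queueSpec t)))
    ◻ .input (fun p : P => Event.peek p) (fun _ => .call (.queueSpec q))
    ◻ (match q with
        | [] => .input (fun p : P => Event.linPeek p none) (fun _ => .call (.queueSpec []))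
        | h :: t => .input (fun p : P => Event.linPeek p (some h))
            (fun _ => .call (.queueSpec (h :: t))))
    ◻ .input (fun x : P × Option P => Event.ret x.1 x.2) (fun _ => .call (.queueSpec q)))

/-- The set `HIDE` of the linearization events of the queue. -/
def queueLin : Set (Event P) :=
  {e | (∃ p v, e = .linEnqueue p v) ∨ (∃ p v, e = .linDequeue p v) ∨ (∃ p v, e = .linPeek p v)}

/-- The set `alpha` of the call and return events of the queue. -/
def queueAlpha : Set (Event P) :=
  {e | (∃ p v, e = .enqueue p v) ∨ (∃ p, e = .dequeue p) ∨ (∃ p, e = .peek p) ∨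
    (∃ p, e = .endEnqueue p) ∨ (∃ p v, e = .ret p v)}

/-- The set `SYNC` of all events of the queue. -/
def queueSync : Set (Event P) := queueAlpha ∪ queueLin

/-- `QUEUE(users)`. -/
def queue (users : Finset P) : Term P :=
  .hide (.par queueSync (.interleave (fun u : users => .call (.queueUser u.1)))
    (.call (.queueSpec []))) queueLin

/-! ### Claim and release -/

/-- `setState.pid!ACTIVE → end_claim.pid → SKIP`. -/
def claimDone (pid : P) : Term P :=
  Event.state .store pid .active ⟿ Event.endClaim pid ⟿ .skip

/-- The final part of an unsuccessful claim: try to go from `ENGAGING` to `WAITING`; on success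
yield, on failure become `ACTIVE`. -/
def claimWait (pid : P) : Term P :=
  .input (fun succ : Bool => Event.casState pid .engaging .waiting succ) (fun succ =>
    if succ then yieldProc pid ⨾ (Event.endClaim pid ⟿ .skip) else claimDone pid)

/-- `CLAIM(pid)`. -/
def claim (pid : P) : Term P :=
  Event.beginClaim pid ⟿
  Event.state .store pid .engaging ⟿
  Event.enqueue pid pid ⟿ Event.endEnqueue pid ⟿
  Event.peek pid ⟿ .input (fun headQ : Option P => Event.ret pid headQ) (fun headQ =>
    if headQ = some pid then
      .input (fun succ : Bool => Event.ownerCas none (some pid) succ) (fun succ =>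
        if succ then claimDone pid
        else
          .input (fun own : Option P => Event.owner .load own) (fun own =>
            if own = none then Event.owner .store (some pid) ⟿ claimDone pid
            else if own = some pid then claimWait pid
            else
              .input (fun succ : Bool => Event.ownerCas own (some pid) succ) (fun succ =>
                if succ then claimDone pid
                else
                  .input (fun succ : Bool => Event.ownerCas none (some pid) succ) (fun succ =>
                    if succ then claimDone pid else claimWait pid))))
    else claimWait pid)

/-- `RELEASE(pid)`. -/
def release (pid : P) : Term P :=
  Event.beginRelease pid ⟿
  Event.dequeue pid ⟿ Event.ret pid (some pid) ⟿
  Event.peek pid ⟿ .input (fun headQ : Option P => Event.ret pid headQ) (fun headQ =>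
    match headQ with
    | none =>
        .input (fun succ : Bool => Event.ownerCas (some pid) none succ) (fun _ =>
          Event.endRelease pid ⟿ .skip)
    | some h =>
        .input (fun succ : Bool => Event.ownerCas (some pid) (some h) succ) (fun succ =>
          if succ then schedule h ⨾ (Event.endRelease pid ⟿ .skip)
          else Event.endRelease pid ⟿ .skip))

/-! ### The mutex specification -/

/-- `user ≠ NULL & P(user)`. -/
def whenOwned (user : Option P) (body : P → Term P) : Term P :=
  match user with
  | none => .dead
  | some u => body u

/-- The body of `MUTEX_SPEC(user)`. -/
def mutexSpecBody (users : Finset P) (user : Option P) : Term P :=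
  .input (fun p : P => Event.beginClaim p) (fun _ => .call (.mutexSpec user))
  ◻ .guarded (user = none)
      (.input (fun p : users => Event.linClaim p.1) (fun p => .call (.mutexSpec (some p.1))))
  ◻ whenOwned user (fun u => Event.endClaim u ⟿ .call (.mutexSpec user))
  ◻ whenOwned user (fun u => Event.beginRelease u ⟿ .call (.mutexSpec user))
  ◻ whenOwned user (fun u => Event.linRelease u ⟿ .call (.mutexSpec none))
  ◻ .input (fun p : P => Event.endRelease p) (fun _ => .call (.mutexSpec user))

/-- The body of `USER(pid)` of the specification. -/
def specUserBody (pid : P) : Term P :=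
  Event.beginClaim pid ⟿ Event.linClaim pid ⟿ Event.endClaim pid ⟿
    Event.beginRelease pid ⟿ Event.linRelease pid ⟿ Event.endRelease pid ⟿
      .call (.specUser pid)

/-! ### The complete systems -/

/-- The defining equations of all named processes. -/
def definitions (users : Finset P) (max : ℕ) : Name P → Term P
  | .ownerVar v =>
      atomicVariable (Event.owner .load) (Event.owner .store) Event.ownerCas
        (fun w => .call (.ownerVar w)) v
  | .stateVar p s =>
      atomicVariable (Event.state .load p) (Event.state .store p) (Event.casState p)
        (fun t => .call (.stateVar p t)) s
  | .queueUser p => queueUserBody p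
  | .queueSpec q => queueSpecBody max q
  | .implUser p => claim p ⨾ release p ⨾ .call (.implUser p)
  | .specUser p => specUserBody p
  | .mutexSpec user => mutexSpecBody users user

/-- The set `DATA` of the events of the shared variables and of the queue. -/
def dataEvents : Set (Event P) :=
  queueAlpha ∪ {e | (∃ op v, e = .owner op v) ∨ (∃ x y b, e = .ownerCas x y b) ∨
    (∃ op p s, e = .state op p s) ∨ (∃ p x y b, e = .casState p x y b)}

/-- The three-fold interleaving `P ||| Q ||| R` is `P ||| (Q ||| R)`, where `|||` is parallel
composition without synchronisation. -/
def system (users : Finset P) : Term P :=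
  .par dataEvents (.par ∅ (queue users) (.par ∅ stateVar owner))
    (.interleave (fun u : users => .call (.implUser u.1)))

/-- `IMPL`: the system with all data events hidden. -/
def impl (users : Finset P) : Term P := .hide (system users) dataEvents

/-- All events of the mutex specification. -/
def alphaSpec : Set (Event P) :=
  {e | ∃ p, e = .beginClaim p ∨ e = .linClaim p ∨ e = .endClaim p ∨
    e = .beginRelease p ∨ e = .linRelease p ∨ e = .endRelease p}

/-- The linearization events of the mutex specification. -/
def linEvents : Set (Event P) := {e | ∃ p, e = .linClaim p ∨ e = .linRelease p}

/-- `SPEC`. -/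
def spec (users : Finset P) : Term P :=
  .hide (.par alphaSpec (.interleave (fun u : users => .call (.specUser u.1)))
    (.call (.mutexSpec none))) linEvents

end Model

end ClaimRelease

/-! Neither system diverges, so both refinements reduce to inclusions between stable failures,
proved by a weak simulation in each direction together with a comparison of refusals in stable
states.

The process terms are first replaced by transition systems on plain data. A state of the
implementation consists of the value of OWNER, the state variables, the queue, and one control state
per user; a control state also records the progress of that user's call to the queue. By
`implTerm_step` and `Move.implTerm_step` the steps of the term are the moves of single users,
provided that the queue is within its capacity; `specTerm_step` and `SpecMove.specTerm_step` do the
same for the specification. Divergence is excluded by ranks (`divergences_impl`,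
`divergences_spec`): the control flow between two visible events of a user has no loop, so every
internal move lowers the sum of the ranks.

From implementation to specification, the abstract owner of the mutex is the head of the queue, not
the value of OWNER. A claim takes effect when its user reaches the head: either on enqueuing into an
empty queue, or when its predecessor dequeues. The latter is matched by a `linRelease` followed by
the `linClaim` of the new head (`Move.specOf_runs`). That the claim ends only at the head, and that
no wake-up is lost, is the content of the invariant `Inv`. It says that ownership lies either with
the head, which then knows it, has been scheduled or is about to be, or with a releaser that is
about to give it up; if OWNER is or will become NULL, the head is still on its way to take it. Hence
in a stable state the head is ready for a visible event (`Inv.head_of_quiescent`), and the abstract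
state is stable with at least the same refusals (`Inv.refuses`). The invariant also makes the queue
a duplicate-free list of users, which keeps it within its capacity.

From specification to implementation, it suffices to run each operation without interference: a
`linClaim` becomes the whole internal part of a claim on an empty queue, a `linRelease` that of a
release (`SpecMove.moves`). The state so reached need not be stable, since claims may be pending
while the mutex is held; `exists_waiting` drives those claims to the point where they wait, and the
resulting state has the required refusals. -/

namespace CSP

/-! ### Inversion of the transition rules -/

section StepCharacterisations

variable {E K : Type} {defs : K → Proc E K}

@[simp] theorem step_dead_iff {l : Label E} {T : Proc E K} :
    Step defs .dead l T ↔ False := ⟨nofun, False.elim⟩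

@[simp] theorem step_skip_iff {l : Label E} {T : Proc E K} :
    Step defs .skip l T ↔ l = .vis .tick ∧ T = .omega := by
  constructor
  · intro h; cases h; exact ⟨rfl, rfl⟩
  · rintro ⟨rfl, rfl⟩; exact .skip

@[simp] theorem step_input_iff {α : Type} {c : α → E} {P : α → Proc E K} {l : Label E}
    {T : Proc E K} :
    Step defs (.input c P) l T ↔ ∃ x, l = .vis (.ev (c x)) ∧ T = P x := by
  constructor
  · intro h; cases h; exact ⟨_, rfl, rfl⟩
  · rintro ⟨x, rfl, rfl⟩; exact .input c P x

@[simp] theorem step_pre_iff {e : E} {P : Proc E K} {l : Label E} {T : Proc E K} :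
    Step defs (Proc.pre e P) l T ↔ l = .vis (.ev e) ∧ T = P := by
  simp [Proc.pre]

theorem step_call_iff {k : K} {l : Label E} {T : Proc E K} :
    Step defs (.call k) l T ↔ Step defs (defs k) l T :=
  ⟨fun h => by cases h; assumption, .call⟩

@[simp] theorem step_extChoice_iff {P Q : Proc E K} {l : Label E} {T : Proc E K} :
    Step defs (.extChoice P Q) l T ↔
      (l ≠ .tau ∧ (Step defs P l T ∨ Step defs Q l T)) ∨
      (l = .tau ∧ ((∃ P', Step defs P .tau P' ∧ T = .extChoice P' Q) ∨
        ∃ Q', Step defs Q .tau Q' ∧ T = .extChoice P Q')) := by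
  constructor
  · intro h
    cases h with
    | ext_left h => exact .inl ⟨nofun, .inl h⟩
    | ext_right h => exact .inl ⟨nofun, .inr h⟩
    | ext_tau_left h => exact .inr ⟨rfl, .inl ⟨_, h, rfl⟩⟩
    | ext_tau_right h => exact .inr ⟨rfl, .inr ⟨_, h, rfl⟩⟩
  · rintro (⟨hl, h⟩ | ⟨rfl, ⟨P', h, rfl⟩ | ⟨Q', h, rfl⟩⟩)
    · cases l with
      | tau => exact absurd rfl hl
      | vis o => exact h.elim .ext_left .ext_right
    · exact .ext_tau_left h
    · exact .ext_tau_right h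

theorem step_extChoice_vis_iff {P Q : Proc E K} {o : Obs E} {T : Proc E K} :
    Step defs (.extChoice P Q) (.vis o) T ↔ Step defs P (.vis o) T ∨ Step defs Q (.vis o) T := by
  simp

theorem step_extChoice_tau_iff {P Q : Proc E K} {T : Proc E K} :
    Step defs (.extChoice P Q) .tau T ↔ (∃ P', Step defs P .tau P' ∧ T = .extChoice P' Q) ∨
        ∃ Q', Step defs Q .tau Q' ∧ T = .extChoice P Q' := by
  simp

@[simp] theorem step_seq_iff {P Q : Proc E K} {l : Label E} {T : Proc E K} :
    Step defs (.seq P Q) l T ↔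
      (l ≠ .vis .tick ∧ ∃ P', Step defs P l P' ∧ T = .seq P' Q) ∨
      (l = .tau ∧ T = Q ∧ ∃ P', Step defs P (.vis .tick) P') := by
  constructor
  · intro h
    cases h with
    | seq_left hl h => exact .inl ⟨hl, _, h, rfl⟩
    | seq_tick h => exact .inr ⟨rfl, rfl, _, h⟩
  · rintro (⟨hl, P', h, rfl⟩ | ⟨rfl, rfl, P', h⟩)
    · exact .seq_left hl h
    · exact .seq_tick h

/-- A prefix cannot terminate, so only the left rule for `⨾` applies. The variants below cover the
other heads of a user process, and the nesting of two `⨾` that arises when YIELD or SCHEDULE is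
called inside CLAIM or RELEASE. -/
theorem step_seq_pre_iff {e : E} {P Q : Proc E K} {l : Label E} {T : Proc E K} :
    Step defs ((e ⟿ P) ⨾ Q) l T ↔ l = .vis (.ev e) ∧ T = P ⨾ Q := by
  simp only [step_seq_iff, step_pre_iff]
  aesop

theorem step_seq_input_iff {α : Type} {c : α → E} {P : α → Proc E K} {Q : Proc E K} {l : Label E}
    {T : Proc E K} :
    Step defs (.input c P ⨾ Q) l T ↔ ∃ x, l = .vis (.ev (c x)) ∧ T = P x ⨾ Q := by
  simp only [step_seq_iff, step_input_iff]
  aesop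

theorem step_seq_skip_iff {Q : Proc E K} {l : Label E} {T : Proc E K} :
    Step defs (.skip ⨾ Q) l T ↔ l = .tau ∧ T = Q := by
  simp only [step_seq_iff, step_skip_iff]
  aesop

theorem step_seq_seq_pre_iff {e : E} {P Q R : Proc E K} {l : Label E} {T : Proc E K} :
    Step defs (((e ⟿ P) ⨾ Q) ⨾ R) l T ↔ l = .vis (.ev e) ∧ T = (P ⨾ Q) ⨾ R := by
  rw [step_seq_iff]
  simp only [step_seq_pre_iff]
  aesop

theorem step_seq_seq_input_iff {α : Type} {c : α → E} {P : α → Proc E K} {Q R : Proc E K}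
    {l : Label E} {T : Proc E K} :
    Step defs ((.input c P ⨾ Q) ⨾ R) l T ↔ ∃ x, l = .vis (.ev (c x)) ∧ T = (P x ⨾ Q) ⨾ R := by
  rw [step_seq_iff]
  simp only [step_seq_input_iff]
  aesop

theorem step_seq_seq_skip_iff {Q R : Proc E K} {l : Label E} {T : Proc E K} :
    Step defs ((.skip ⨾ Q) ⨾ R) l T ↔ l = .tau ∧ T = Q ⨾ R := by
  rw [step_seq_iff]
  simp only [step_seq_skip_iff]
  aesop

/-- The process can neither terminate nor has it terminated. -/
def NoTick (defs : K → Proc E K) (P : Proc E K) : Prop :=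
  P ≠ .omega ∧ ∀ T, ¬ Step defs P (.vis .tick) T

/-- The hypotheses rule out the three rules for distributed termination; what remains is
synchronisation and independent steps. -/
theorem step_par_iff {A : Set E} {P Q : Proc E K} {l : Label E} {T : Proc E K}
    (hP : NoTick defs P) (hQ : NoTick defs Q) :
    Step defs (.par A P Q) l T ↔
      ((∀ e ∈ A, l ≠ .vis (.ev e)) ∧
        ((∃ P', Step defs P l P' ∧ T = .par A P' Q) ∨
          ∃ Q', Step defs Q l Q' ∧ T = .par A P Q')) ∨
      ∃ e ∈ A, l = .vis (.ev e) ∧ ∃ P' Q', Step defs P l P' ∧ Step defs Q l Q' ∧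
        T = .par A P' Q' := by
  constructor
  · intro h
    cases h with
    | par_tau_left h => exact .inl ⟨nofun, .inl ⟨_, h, rfl⟩⟩
    | par_tau_right h => exact .inl ⟨nofun, .inr ⟨_, h, rfl⟩⟩
    | par_left he h =>
      exact .inl ⟨fun e' he' heq => by cases heq; exact he he', .inl ⟨_, h, rfl⟩⟩
    | par_right he h =>
      exact .inl ⟨fun e' he' heq => by cases heq; exact he he', .inr ⟨_, h, rfl⟩⟩
    | par_sync he h h' => exact .inr ⟨_, he, rfl, _, _, h, h', rfl⟩
    | par_tick_left h => exact absurd h (hP.2 _)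
    | par_tick_right h => exact absurd h (hQ.2 _)
    | par_tick => exact absurd rfl hP.1
  · rintro (⟨hl, ⟨P', h, rfl⟩ | ⟨Q', h, rfl⟩⟩ | ⟨e, he, rfl, P', Q', h, h', rfl⟩)
    · match l with
      | .tau => exact .par_tau_left h
      | .vis .tick => exact absurd h (hP.2 _)
      | .vis (.ev e) => exact .par_left (fun he => hl e he rfl) h
    · match l with
      | .tau => exact .par_tau_right h
      | .vis .tick => exact absurd h (hQ.2 _)
      | .vis (.ev e) => exact .par_right (fun he => hl e he rfl) h
    · exact .par_sync he h h'

theorem NoTick.par {A : Set E} {P Q : Proc E K} (hP : NoTick defs P) (hQ : NoTick defs Q) :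
    NoTick defs (.par A P Q) := by
  refine ⟨nofun, fun T h => ?_⟩
  rw [step_par_iff hP hQ] at h
  rcases h with ⟨-, ⟨P', h, -⟩ | ⟨Q', h, -⟩⟩ | ⟨e, -, h, -⟩
  · exact hP.2 _ h
  · exact hQ.2 _ h
  · cases h

/-- Nonemptiness matters: an interleaving over the empty type terminates at once. -/
theorem step_interleave_iff {ι : Type} [DecidableEq ι] [Nonempty ι] {P : ι → Proc E K}
    {l : Label E} {T : Proc E K} (hP : ∀ i, NoTick defs (P i)) :
    Step defs (.interleave P) l T ↔
      ∃ i T', Step defs (P i) l T' ∧ T = .interleave (Function.update P i T') := by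
  constructor
  · intro h
    cases h with
    | @interleave_step _ _ P' _ i hl h hj =>
      refine ⟨i, _, h, congrArg _ ?_⟩
      funext j
      by_cases hji : j = i
      · subst hji; simp
      · simp [hji, hj j hji]
    | interleave_tick_one i h => exact absurd h ((hP i).2 _)
    | interleave_tick h => exact absurd (h (Classical.arbitrary ι)) (hP _).1
  · rintro ⟨i, T', h, rfl⟩
    refine .interleave_step i ?_ (by simpa using h) (fun j hj => by simp [hj])
    rintro rfl
    exact (hP i).2 _ h

theorem NoTick.interleave {ι : Type} [Nonempty ι] {P : ι → Proc E K}
    (hP : ∀ i, NoTick defs (P i)) : NoTick defs (.interleave P) := by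
  classical
  refine ⟨nofun, fun T h => ?_⟩
  obtain ⟨i, T', h, -⟩ := (step_interleave_iff hP).1 h
  exact (hP i).2 _ h

theorem step_hide_iff {A : Set E} {P : Proc E K} {l : Label E} {T : Proc E K}
    (hP : NoTick defs P) :
    Step defs (.hide P A) l T ↔
      ∃ P', T = .hide P' A ∧ (((∀ e ∈ A, l ≠ .vis (.ev e)) ∧ Step defs P l P') ∨
        (l = .tau ∧ ∃ e ∈ A, Step defs P (.vis (.ev e)) P')) := by
  constructor
  · intro h
    cases h with
    | hide_tau h => exact ⟨_, rfl, .inl ⟨nofun, h⟩⟩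
    | hide_hidden he h => exact ⟨_, rfl, .inr ⟨rfl, _, he, h⟩⟩
    | hide_visible he h =>
      exact ⟨_, rfl, .inl ⟨fun e' he' heq => by cases heq; exact he he', h⟩⟩
    | hide_tick h => exact absurd h (hP.2 _)
  · rintro ⟨P', rfl, ⟨hl, h⟩ | ⟨rfl, e, he, h⟩⟩
    · match l with
      | .tau => exact .hide_tau h
      | .vis .tick => exact absurd h (hP.2 _)
      | .vis (.ev e) => exact .hide_visible (fun he => hl e he rfl) h
    · exact .hide_hidden he h

theorem NoTick.hide {A : Set E} {P : Proc E K} (hP : NoTick defs P) :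
    NoTick defs (.hide P A) := by
  refine ⟨nofun, fun T h => ?_⟩
  rw [step_hide_iff hP] at h
  obtain ⟨P', -, ⟨-, h⟩ | ⟨h, -⟩⟩ := h
  · exact hP.2 _ h
  · cases h

theorem step_par_empty_iff {P Q : Proc E K} {l : Label E} {T : Proc E K}
    (hP : NoTick defs P) (hQ : NoTick defs Q) :
    Step defs (.par ∅ P Q) l T ↔
      (∃ P', Step defs P l P' ∧ T = .par ∅ P' Q) ∨ ∃ Q', Step defs Q l Q' ∧ T = .par ∅ P Q' := by
  simp [step_par_iff hP hQ]

/-- The steps of a hidden parallel composition of processes that synchronise on all their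
actions. -/
theorem step_hide_sync_iff {A B : Set E} {P Q : Proc E K} {l : Label E} {T : Proc E K}
    (hP : ∀ {l T}, Step defs P l T → ∃ e ∈ A, l = .vis (.ev e)) (hP' : P ≠ .omega)
    (hQ : ∀ {l T}, Step defs Q l T → ∃ e ∈ A, l = .vis (.ev e)) (hQ' : Q ≠ .omega) :
    Step defs (.hide (.par A P Q) B) l T ↔ ∃ e ∈ A, ((e ∉ B ∧ l = .vis (.ev e)) ∨
      (e ∈ B ∧ l = .tau)) ∧ ∃ P' Q', Step defs P (.vis (.ev e)) P' ∧
        Step defs Q (.vis (.ev e)) Q' ∧ T = .hide (.par A P' Q') B := by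
  have tP : NoTick defs P := ⟨hP', fun T h => by simpa using hP h⟩
  have tQ : NoTick defs Q := ⟨hQ', fun T h => by simpa using hQ h⟩
  have hpar : ∀ l T, Step defs (.par A P Q) l T ↔ ∃ e ∈ A, l = .vis (.ev e) ∧ ∃ P' Q',
      Step defs P l P' ∧ Step defs Q l Q' ∧ T = .par A P' Q' := by
    intro l T
    rw [step_par_iff tP tQ, or_iff_right]
    rintro ⟨hn, ⟨P', h, -⟩ | ⟨Q', h, -⟩⟩
    · obtain ⟨e, he, rfl⟩ := hP h
      exact hn e he rfl
    · obtain ⟨e, he, rfl⟩ := hQ h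
      exact hn e he rfl
  rw [step_hide_iff (tP.par tQ)]
  simp only [hpar]
  constructor
  · rintro ⟨_, rfl, ⟨hn, e, he, rfl, P', Q', h, h', rfl⟩ |
      ⟨rfl, e, he, _, he', ⟨⟩, P', Q', h, h', rfl⟩⟩
    · exact ⟨e, he, .inl ⟨fun hB => hn e hB rfl, rfl⟩, P', Q', h, h', rfl⟩
    · exact ⟨e, he', .inr ⟨he, rfl⟩, P', Q', h, h', rfl⟩
  · rintro ⟨e, he, ⟨hB, rfl⟩ | ⟨hB, rfl⟩, P', Q', h, h', rfl⟩
    · exact ⟨_, rfl, .inl ⟨by rintro _ hB' ⟨⟩; exact hB hB', e, he, rfl, P', Q', h, h', rfl⟩⟩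
    · exact ⟨_, rfl, .inr ⟨rfl, e, hB, e, he, rfl, P', Q', h, h', rfl⟩⟩

/-- The steps of a parallel composition of which the synchronised events are hidden and are the
only events of the left process. -/
theorem step_hide_server_iff {A : Set E} {P Q : Proc E K} {l : Label E} {T : Proc E K}
    (tP : NoTick defs P) (tQ : NoTick defs Q)
    (hP : ∀ {e T}, Step defs P (.vis (.ev e)) T → e ∈ A) :
    Step defs (.hide (.par A P Q) A) l T ↔
      (l = .tau ∧ ∃ P', Step defs P .tau P' ∧ T = .hide (.par A P' Q) A) ∨
      ((∀ e ∈ A, l ≠ .vis (.ev e)) ∧ ∃ Q', Step defs Q l Q' ∧ T = .hide (.par A P Q') A) ∨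
      (l = .tau ∧ ∃ e ∈ A, ∃ P' Q', Step defs P (.vis (.ev e)) P' ∧
        Step defs Q (.vis (.ev e)) Q' ∧ T = .hide (.par A P' Q') A) := by
  rw [step_hide_iff (tP.par tQ)]
  simp only [step_par_iff tP tQ]
  constructor
  · rintro ⟨_, rfl, ⟨hn, ⟨-, ⟨P', h, rfl⟩ | ⟨Q', h, rfl⟩⟩ | ⟨e, he, rfl, -⟩⟩ |
      ⟨rfl, e, he, ⟨hn, -⟩ | ⟨_, -, ⟨⟩, P', Q', h, h', rfl⟩⟩⟩
    · match l with
      | .tau => exact .inl ⟨rfl, P', h, rfl⟩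
      | .vis .tick => exact absurd h (tP.2 _)
      | .vis (.ev e) => exact absurd rfl (hn e (hP h))
    · exact .inr (.inl ⟨hn, Q', h, rfl⟩)
    · exact absurd rfl (hn e he)
    · exact absurd rfl (hn e he)
    · exact .inr (.inr ⟨rfl, e, he, P', Q', h, h', rfl⟩)
  · rintro (⟨rfl, P', h, rfl⟩ | ⟨hn, Q', h, rfl⟩ | ⟨rfl, e, he, P', Q', h, h', rfl⟩)
    · exact ⟨_, rfl, .inl ⟨nofun, .inl ⟨nofun, .inl ⟨P', h, rfl⟩⟩⟩⟩
    · exact ⟨_, rfl, .inl ⟨hn, .inl ⟨hn, .inr ⟨Q', h, rfl⟩⟩⟩⟩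
    · exact ⟨_, rfl, .inr ⟨rfl, e, he, .inr ⟨e, he, rfl, P', Q', h, h', rfl⟩⟩⟩

end StepCharacterisations

/-! ### Runs, and divergence freedom by ranking -/

section Refinement

variable {E K : Type} {defs : K → Proc E K}

/-- The trace contribution of a label. -/
def Label.trace : Label E → List (Obs E)
  | .tau => []
  | .vis o => [o]

theorem Runs.step {P P' Q : Proc E K} {l : Label E} {s : List (Obs E)}
    (h : Step defs P l P') (h' : Runs defs P' s Q) : Runs defs P (l.trace ++ s) Q := by
  cases l with
  | tau => exact .tau h h'
  | vis o => exact .vis h h'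

theorem Runs.append {P Q R : Proc E K} {s t : List (Obs E)}
    (h : Runs defs P s Q) (h' : Runs defs Q t R) : Runs defs P (s ++ t) R := by
  induction h with
  | nil => exact h'
  | tau h _ ih => exact .tau h (ih h')
  | vis h _ ih => exact .vis h (ih h')

/-- A process has no divergences if its reachable states can be given ranks that are decreased
by every internal action. -/
theorem divergences_eq_empty {P : Proc E K} (I : ℕ → Proc E K → Prop) {n : ℕ} (hI : I n P)
    (hstep : ∀ n Q l Q', I n Q → Step defs Q l Q' → ∃ m, I m Q' ∧ (l = .tau → m < n)) :
    divergences defs P = ∅ := by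
  have hruns : ∀ {Q s Q'}, Runs defs Q s Q' → ∀ n, I n Q → ∃ m, I m Q' := by
    intro Q s Q' h
    induction h with
    | nil => exact fun n hQ => ⟨n, hQ⟩
    | tau h _ ih => exact fun n hQ => (hstep _ _ _ _ hQ h).elim fun m hm => ih m hm.1
    | vis h _ ih => exact fun n hQ => (hstep _ _ _ _ hQ h).elim fun m hm => ih m hm.1
  -- An infinite internal path yields, after its first step, an infinite internal path from a state
  -- of smaller rank.
  have hdiv : ∀ n Q, I n Q → ¬ Diverges defs Q := by
    intro n
    induction n using Nat.strong_induction_on with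
    | _ n ih =>
      rintro Q hQ ⟨f, rfl, hf⟩
      obtain ⟨m, hm, hlt⟩ := hstep _ _ _ _ hQ (hf 0)
      exact ih m (hlt rfl) _ hm ⟨fun k => f (k + 1), rfl, fun k => hf (k + 1)⟩
  ext u
  simp only [Set.mem_empty_iff_false, iff_false]
  rintro ⟨-, s, Q, -, -, hr, hd⟩
  obtain ⟨m, hm⟩ := hruns hr _ hI
  exact hdiv m Q hm hd

end Refinement

end CSP

/-! ### The protocol as a transition system on data -/

namespace ClaimRelease
open CSP

variable {P : Type}

/-- The control states of a user of the implementation, together with the corresponding user of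
the queue. -/
inductive Control (P : Type) : Type
  | idle
  | begun
  | engaged
  | enqueuing
  | enqueued
  | toPeek
  | peeking
  | peeked (v : Option P)
  | casNull
  | loadOwner
  | storeOwner
  | casFrom (o : Option P)
  | casNullAgain
  | toWait
  | yielding
  | resuming
  | resumed
  | toActivate
  | toEndClaim
  | claimEnded
  | holding
  | toDequeue
  | dequeuing
  | dequeued (v : Option P)
  | toPeekNext
  | peekingNext
  | peekedNext (v : Option P)
  | casToNull
  | casTo (h : P)
  | scheduling (h : P)
  | schedulingWaiter (h : P)
  | scheduleDone
  | toEndRelease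
  | releaseEnded

/-- The data shared by the users. -/
structure Shared (P : Type) : Type where
  owner : Option P
  st : P → UState
  q : List P

open Control

section Terms

variable [DecidableEq P]

/-- What follows a claim. -/
def afterClaim (p : P) (T : Term P) : Term P := T ⨾ release p ⨾ .call (.implUser p)

/-- What remains of a release. -/
def inRelease (p : P) (T : Term P) : Term P := T ⨾ .call (.implUser p)

/-- The residual process of a user of the implementation. -/
def userTerm (p : P) : Control P → Term P
  | idle => .call (.implUser p)
  | begun => afterClaim p (Event.state .store p .engaging ⟿
      Event.enqueue p p ⟿ Event.endEnqueue p ⟿ Event.peek p ⟿ claimPeeked)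
  | engaged => afterClaim p (Event.enqueue p p ⟿ Event.endEnqueue p ⟿ Event.peek p ⟿ claimPeeked)
  | enqueuing | enqueued => afterClaim p (Event.endEnqueue p ⟿ Event.peek p ⟿ claimPeeked)
  | toPeek => afterClaim p (Event.peek p ⟿ claimPeeked)
  | peeking | peeked _ => afterClaim p claimPeeked
  | casNull => afterClaim p claimCasNull
  | loadOwner => afterClaim p claimLoadOwner
  | storeOwner => afterClaim p (Event.owner .store (some p) ⟿ claimDone p)
  | casFrom o => afterClaim p (claimCasFrom o)
  | casNullAgain => afterClaim p claimCasNullAgain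
  | toWait => afterClaim p (claimWait p)
  | yielding => afterClaim p (yieldProc p ⨾ (Event.endClaim p ⟿ .skip))
  | resuming => afterClaim p ((Event.state .store p .active ⟿ .skip) ⨾ (Event.endClaim p ⟿ .skip))
  | resumed => afterClaim p (.skip ⨾ (Event.endClaim p ⟿ .skip))
  | toActivate => afterClaim p (claimDone p)
  | toEndClaim => afterClaim p (Event.endClaim p ⟿ .skip)
  | claimEnded => afterClaim p .skip
  | holding => inRelease p (release p)
  | toDequeue => inRelease p (Event.dequeue p ⟿ Event.ret p (some p) ⟿ Event.peek p ⟿ nextPeeked)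
  | dequeuing | dequeued _ => inRelease p (Event.ret p (some p) ⟿ Event.peek p ⟿ nextPeeked)
  | toPeekNext => inRelease p (Event.peek p ⟿ nextPeeked)
  | peekingNext | peekedNext _ => inRelease p nextPeeked
  | casToNull => inRelease p (.input (fun succ : Bool => Event.ownerCas (some p) none succ)
      (fun _ => Event.endRelease p ⟿ .skip))
  | casTo h => inRelease p (releaseCasTo h)
  | scheduling h => inRelease p (schedule h ⨾ (Event.endRelease p ⟿ .skip))
  | schedulingWaiter h => inRelease p
      (.input (fun b : Bool => Event.casState h .waiting .scheduled b) (fun _ => .skip) ⨾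
        (Event.endRelease p ⟿ .skip))
  | scheduleDone => inRelease p (.skip ⨾ (Event.endRelease p ⟿ .skip))
  | toEndRelease => inRelease p (Event.endRelease p ⟿ .skip)
  | releaseEnded => inRelease p .skip
where
  /-- The claim, awaiting the head of the queue. -/
  claimPeeked : Term P := .input (fun headQ : Option P => Event.ret p headQ) (fun headQ =>
    if headQ = some p then claimCasNull else claimWait p)
  /-- The claim, about to try and take the ownership from nobody. -/
  claimCasNull : Term P := .input (fun succ : Bool => Event.ownerCas none (some p) succ)
    (fun succ => if succ then claimDone p else claimLoadOwner)
  /-- The claim, about to read the owner. -/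
  claimLoadOwner : Term P := .input (fun own : Option P => Event.owner .load own) (fun own =>
    if own = none then Event.owner .store (some p) ⟿ claimDone p
    else if own = some p then claimWait p else claimCasFrom own)
  /-- The claim, about to try and take the ownership from `own`. -/
  claimCasFrom (own : Option P) : Term P :=
    .input (fun succ : Bool => Event.ownerCas own (some p) succ)
      (fun succ => if succ then claimDone p else claimCasNullAgain)
  /-- The claim, about to try again and take the ownership from nobody. -/
  claimCasNullAgain : Term P := .input (fun succ : Bool => Event.ownerCas none (some p) succ)
    (fun succ => if succ then claimDone p else claimWait p)
  /-- The release, awaiting the new head of the queue. -/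
  nextPeeked : Term P := .input (fun headQ : Option P => Event.ret p headQ) (fun headQ =>
    match headQ with
    | none =>
        .input (fun succ : Bool => Event.ownerCas (some p) none succ) (fun _ =>
          Event.endRelease p ⟿ .skip)
    | some h => releaseCasTo h)
  /-- The release, about to try and pass the ownership to `h`. -/
  releaseCasTo (h : P) : Term P :=
    .input (fun succ : Bool => Event.ownerCas (some p) (some h) succ) (fun succ =>
      if succ then schedule h ⨾ (Event.endRelease p ⟿ .skip)
      else Event.endRelease p ⟿ .skip)

/-- The residual process of a user of the queue. -/
def queueUserTerm (p : P) : Control P → Term P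
  | enqueuing => Event.linEnqueue p p ⟿ Event.endEnqueue p ⟿ .call (.queueUser p)
  | enqueued => Event.endEnqueue p ⟿ .call (.queueUser p)
  | dequeuing => .input (fun val : Option P => Event.linDequeue p val) (fun val =>
      Event.ret p val ⟿ .call (.queueUser p))
  | peeking | peekingNext => .input (fun val : Option P => Event.linPeek p val) (fun val =>
      Event.ret p val ⟿ .call (.queueUser p))
  | peeked v | dequeued v | peekedNext v => Event.ret p v ⟿ .call (.queueUser p)
  | _ => .call (.queueUser p)

/-- `Move p s c l s' c'`: with shared data `s`, the user `p` in control state `c` can perform `l`,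
changing the shared data to `s'` and its control state to `c'`. -/
inductive Move (p : P) : Shared P → Control P → Label (Event P) → Shared P → Control P → Prop
  | beginClaim (s) : Move p s idle (.vis (.ev (.beginClaim p))) s begun
  | engage (s) : Move p s begun .tau { s with st := Function.update s.st p .engaging } engaged
  | enqueue (s) : Move p s engaged .tau s enqueuing
  | linEnqueue (s) : Move p s enqueuing .tau { s with q := s.q ++ [p] } enqueued
  | endEnqueue (s) : Move p s enqueued .tau s toPeek
  | peek (s) : Move p s toPeek .tau s peeking
  | linPeek (s) : Move p s peeking .tau s (peeked s.q.head?)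
  | peekedSelf (s) : Move p s (peeked (some p)) .tau s casNull
  | peekedOther (s v) : v ≠ some p → Move p s (peeked v) .tau s toWait
  | casNull (s) : s.owner = none →
      Move p s casNull .tau { s with owner := some p } toActivate
  | casNullFail (s) : s.owner ≠ none → Move p s casNull .tau s loadOwner
  | loadNull (s) : s.owner = none → Move p s loadOwner .tau s storeOwner
  | loadSelf (s) : s.owner = some p → Move p s loadOwner .tau s toWait
  | loadOther (s) : s.owner ≠ none → s.owner ≠ some p →
      Move p s loadOwner .tau s (casFrom s.owner)
  | storeOwner (s) : Move p s storeOwner .tau { s with owner := some p } toActivate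
  | casFrom (s o) : o = s.owner → Move p s (casFrom o) .tau { s with owner := some p } toActivate
  | casFromFail (s o) : o ≠ s.owner → Move p s (casFrom o) .tau s casNullAgain
  | casNullAgain (s) : s.owner = none →
      Move p s casNullAgain .tau { s with owner := some p } toActivate
  | casNullAgainFail (s) : s.owner ≠ none → Move p s casNullAgain .tau s toWait
  | wait (s) : s.st p = .engaging →
      Move p s toWait .tau { s with st := Function.update s.st p .waiting } yielding
  | waitFail (s) : s.st p ≠ .engaging → Move p s toWait .tau s toActivate
  | resume (s) : s.st p = .scheduled → Move p s yielding .tau s resuming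
  | reactivate (s) :
      Move p s resuming .tau { s with st := Function.update s.st p .active } resumed
  | yielded (s) : Move p s resumed .tau s toEndClaim
  | activate (s) :
      Move p s toActivate .tau { s with st := Function.update s.st p .active } toEndClaim
  | endClaim (s) : Move p s toEndClaim (.vis (.ev (.endClaim p))) s claimEnded
  | claimed (s) : Move p s claimEnded .tau s holding
  | beginRelease (s) : Move p s holding (.vis (.ev (.beginRelease p))) s toDequeue
  | dequeue (s) : Move p s toDequeue .tau s dequeuing
  | linDequeue (s) : Move p s dequeuing .tau { s with q := s.q.tail } (dequeued s.q.head?)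
  | dequeued (s) : Move p s (dequeued (some p)) .tau s toPeekNext
  | peekNext (s) : Move p s toPeekNext .tau s peekingNext
  | linPeekNext (s) : Move p s peekingNext .tau s (peekedNext s.q.head?)
  | nextNull (s) : Move p s (peekedNext none) .tau s casToNull
  | next (s h) : Move p s (peekedNext (some h)) .tau s (casTo h)
  | casToNull (s) : s.owner = some p →
      Move p s casToNull .tau { s with owner := none } toEndRelease
  | casToNullFail (s) : s.owner ≠ some p → Move p s casToNull .tau s toEndRelease
  | casTo (s h) : s.owner = some p →
      Move p s (casTo h) .tau { s with owner := some h } (scheduling h)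
  | casToFail (s h) : s.owner ≠ some p → Move p s (casTo h) .tau s toEndRelease
  | schedule (s h) : s.st h = .engaging → Move p s (scheduling h) .tau
      { s with st := Function.update s.st h .scheduled } scheduleDone
  | scheduleFail (s h) : s.st h ≠ .engaging →
      Move p s (scheduling h) .tau s (schedulingWaiter h)
  | scheduleWaiter (s h) : s.st h = .waiting → Move p s (schedulingWaiter h) .tau
      { s with st := Function.update s.st h .scheduled } scheduleDone
  | scheduleWaiterFail (s h) : s.st h ≠ .waiting →
      Move p s (schedulingWaiter h) .tau s scheduleDone
  | scheduled (s) : Move p s scheduleDone .tau s toEndRelease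
  | endRelease (s) : Move p s toEndRelease (.vis (.ev (.endRelease p))) s releaseEnded
  | released (s) : Move p s releaseEnded .tau s idle

/-- The effect of an access to a shared variable. -/
inductive VarStep : Shared P → Event P → Shared P → Prop
  | loadOwner (s v) : v = s.owner → VarStep s (.owner .load v) s
  | storeOwner (s v) : VarStep s (.owner .store v) { s with owner := v }
  | casOwner (s) (x y : Option P) (b) : b = decide (x = s.owner) → VarStep s (.ownerCas x y b)
      { s with owner := if x = s.owner then y else s.owner }
  | loadState (s p v) : v = s.st p → VarStep s (.state .load p v) s
  | storeState (s p v) : VarStep s (.state .store p v)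
      { s with st := Function.update s.st p v }
  | casState (s p x y b) : b = decide (x = s.st p) → VarStep s (.casState p x y b)
      { s with st := Function.update s.st p (if x = s.st p then y else s.st p) }

/-- The effect of a linearization event of the queue. -/
inductive QueueStep : Shared P → Event P → Shared P → Prop
  | linEnqueue (s p v) : QueueStep s (.linEnqueue p v) { s with q := s.q ++ [v] }
  | linDequeue (s p) : QueueStep s (.linDequeue p s.q.head?) { s with q := s.q.tail }
  | linPeek (s p) : QueueStep s (.linPeek p s.q.head?) s

end Terms

section Alphabets

/-- The call and return events of the queue. -/
def Event.IsQueueCall : Event P → Prop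
  | enqueue _ _ | dequeue _ | peek _ | endEnqueue _ | ret _ _ => True
  | _ => False

/-- The linearization events of the queue. -/
def Event.IsQueueLin : Event P → Prop
  | linEnqueue _ _ | linDequeue _ _ | linPeek _ _ => True
  | _ => False

/-- The events of the shared variables. -/
def Event.IsVar : Event P → Prop
  | owner _ _ | ownerCas _ _ _ | state _ _ _ | casState _ _ _ _ => True
  | _ => False

theorem mem_queueAlpha_iff {e : Event P} : e ∈ queueAlpha (P := P) ↔ e.IsQueueCall := by
  cases e <;> simp [queueAlpha, Event.IsQueueCall]

theorem mem_queueLin_iff {e : Event P} : e ∈ queueLin (P := P) ↔ e.IsQueueLin := by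
  cases e <;> simp [queueLin, Event.IsQueueLin]

theorem mem_queueSync_iff {e : Event P} :
    e ∈ queueSync (P := P) ↔ e.IsQueueCall ∨ e.IsQueueLin := by
  rw [queueSync, Set.mem_union, mem_queueAlpha_iff, mem_queueLin_iff]

theorem mem_dataEvents_iff {e : Event P} :
    e ∈ dataEvents (P := P) ↔ e.IsQueueCall ∨ e.IsVar := by
  rw [dataEvents, Set.mem_union, mem_queueAlpha_iff]
  refine or_congr_right ?_
  cases e <;> simp [Event.IsVar, -Bool.exists_bool]

end Alphabets

end ClaimRelease

/-! ### The user processes in isolation -/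

namespace ClaimRelease
open CSP Control
variable {P : Type}
section Local
variable [DecidableEq P] {users : Finset P} {max : ℕ} {p : P} {s s' : Shared P} {c c' : Control P}
  {l : Label (Event P)} {e : Event P} {T T' : Term P}

/-- `UserAct p c l c'`: the user process of `p` in control state `c`, on its own, can perform `l`
and then be in control state `c'`. -/
inductive UserAct (p : P) : Control P → Label (Event P) → Control P → Prop
  | beginClaim : UserAct p idle (.vis (.ev (.beginClaim p))) begun
  | engage : UserAct p begun (.vis (.ev (.state .store p .engaging))) engaged
  | enqueue : UserAct p engaged (.vis (.ev (.enqueue p p))) enqueuing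
  | endEnqueue_pending : UserAct p enqueuing (.vis (.ev (.endEnqueue p))) toPeek
  | endEnqueue : UserAct p enqueued (.vis (.ev (.endEnqueue p))) toPeek
  | peek : UserAct p toPeek (.vis (.ev (.peek p))) peeking
  | ret_pending (v) : UserAct p peeking (.vis (.ev (.ret p v)))
      (if v = some p then casNull else toWait)
  | ret (w v) : UserAct p (peeked w) (.vis (.ev (.ret p v)))
      (if v = some p then casNull else toWait)
  | casNull (b) : UserAct p casNull (.vis (.ev (.ownerCas none (some p) b)))
      (bif b then toActivate else loadOwner)
  | loadOwner (o) : UserAct p loadOwner (.vis (.ev (.owner .load o)))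
      (if o = none then storeOwner else if o = some p then toWait else casFrom o)
  | storeOwner : UserAct p storeOwner (.vis (.ev (.owner .store (some p)))) toActivate
  | casFrom (o b) : UserAct p (casFrom o) (.vis (.ev (.ownerCas o (some p) b)))
      (bif b then toActivate else casNullAgain)
  | casNullAgain (b) : UserAct p casNullAgain (.vis (.ev (.ownerCas none (some p) b)))
      (bif b then toActivate else toWait)
  | wait (b) : UserAct p toWait (.vis (.ev (.casState p .engaging .waiting b)))
      (bif b then yielding else toActivate)
  | resume : UserAct p yielding (.vis (.ev (.state .load p .scheduled))) resuming
  | reactivate : UserAct p resuming (.vis (.ev (.state .store p .active))) resumed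
  | yielded : UserAct p resumed .tau toEndClaim
  | activate : UserAct p toActivate (.vis (.ev (.state .store p .active))) toEndClaim
  | endClaim : UserAct p toEndClaim (.vis (.ev (.endClaim p))) claimEnded
  | claimed : UserAct p claimEnded .tau holding
  | beginRelease : UserAct p holding (.vis (.ev (.beginRelease p))) toDequeue
  | dequeue : UserAct p toDequeue (.vis (.ev (.dequeue p))) dequeuing
  | dequeued_pending : UserAct p dequeuing (.vis (.ev (.ret p (some p)))) toPeekNext
  | dequeued (w) : UserAct p (dequeued w) (.vis (.ev (.ret p (some p)))) toPeekNext
  | peekNext : UserAct p toPeekNext (.vis (.ev (.peek p))) peekingNext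
  | next_pending (v) : UserAct p peekingNext (.vis (.ev (.ret p v))) (v.elim casToNull casTo)
  | next (w v) : UserAct p (peekedNext w) (.vis (.ev (.ret p v))) (v.elim casToNull casTo)
  | casToNull (b) : UserAct p casToNull (.vis (.ev (.ownerCas (some p) none b))) toEndRelease
  | casTo (h b) : UserAct p (casTo h) (.vis (.ev (.ownerCas (some p) (some h) b)))
      (bif b then scheduling h else toEndRelease)
  | schedule (h b) : UserAct p (scheduling h) (.vis (.ev (.casState h .engaging .scheduled b)))
      (bif b then scheduleDone else schedulingWaiter h)
  | scheduleWaiter (h b) : UserAct p (schedulingWaiter h)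
      (.vis (.ev (.casState h .waiting .scheduled b))) scheduleDone
  | scheduled : UserAct p scheduleDone .tau toEndRelease
  | endRelease : UserAct p toEndRelease (.vis (.ev (.endRelease p))) releaseEnded
  | released : UserAct p releaseEnded .tau idle

theorem userTerm_noTick : NoTick (definitions users max) (userTerm p c) := by
  refine ⟨by cases c <;> nofun, fun T h => ?_⟩
  cases c <;>
    simp [userTerm, afterClaim, inRelease, step_call_iff, definitions, release] at h

theorem queueUserTerm_noTick : NoTick (definitions users max) (queueUserTerm p c) := by
  refine ⟨by cases c <;> nofun, fun T h => ?_⟩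
  cases c <;>
    simp [queueUserTerm, step_call_iff, definitions, queueUserBody] at h

theorem UserAct.step (h : UserAct p c l c') :
    Step (definitions users max) (userTerm p c) l (userTerm p c') := by
  cases h
  case beginClaim => exact .call (step_seq_pre_iff.2 ⟨rfl, rfl⟩)
  case ret_pending v | ret w v =>
    refine step_seq_input_iff.2 ⟨v, rfl, ?_⟩
    split_ifs <;> rfl
  case loadOwner o =>
    refine step_seq_input_iff.2 ⟨o, rfl, ?_⟩
    split_ifs <;> rfl
  case next_pending v | next w v => cases v <;> exact step_seq_input_iff.2 ⟨_, rfl, rfl⟩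
  case casNull b | casFrom o b | casNullAgain b | wait b | casTo h b =>
    cases b <;> exact step_seq_input_iff.2 ⟨_, rfl, rfl⟩
  case schedule h b => cases b <;> exact step_seq_seq_input_iff.2 ⟨_, rfl, rfl⟩
  case casToNull b => exact step_seq_input_iff.2 ⟨_, rfl, rfl⟩
  case scheduleWaiter h b => exact step_seq_seq_input_iff.2 ⟨_, rfl, rfl⟩
  case resume | reactivate => exact step_seq_seq_pre_iff.2 ⟨rfl, rfl⟩
  case yielded | scheduled => exact step_seq_seq_skip_iff.2 ⟨rfl, rfl⟩
  case claimed | released => exact step_seq_skip_iff.2 ⟨rfl, rfl⟩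
  all_goals exact step_seq_pre_iff.2 ⟨rfl, rfl⟩

/-- Alone, a user accepts every loaded value, every CAS result and, except for its own dequeue,
every returned value. The data processes remove the impossible ones later. -/
theorem userAct_of_step
    (h : Step (definitions users max) (userTerm p c) l T) :
    ∃ c', UserAct p c l c' ∧ T = userTerm p c' := by
  cases c <;>
    simp only [userTerm, afterClaim, inRelease, step_call_iff, definitions, claim, release,
      claimDone, claimWait, yieldProc, ClaimRelease.schedule,
      userTerm.claimPeeked, userTerm.claimCasNull, userTerm.claimLoadOwner, userTerm.claimCasFrom,
      userTerm.claimCasNullAgain, userTerm.nextPeeked, userTerm.releaseCasTo,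
      step_seq_pre_iff, step_seq_input_iff, step_seq_skip_iff, step_seq_seq_pre_iff,
      step_seq_seq_input_iff, step_seq_seq_skip_iff] at h
  case peeking | peeked =>
    obtain ⟨v, rfl, rfl⟩ := h
    refine ⟨_, by constructor, ?_⟩
    split_ifs <;> rfl
  case loadOwner =>
    obtain ⟨v, rfl, rfl⟩ := h
    refine ⟨_, by constructor, ?_⟩
    split_ifs <;> rfl
  case peekingNext | peekedNext =>
    obtain ⟨v, rfl, rfl⟩ := h
    cases v <;> exact ⟨_, by constructor, rfl⟩
  case casNull | casFrom | casNullAgain | toWait | casTo | scheduling =>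
    obtain ⟨b, rfl, rfl⟩ := h
    cases b <;> exact ⟨_, by constructor, rfl⟩
  case casToNull | schedulingWaiter =>
    obtain ⟨b, rfl, rfl⟩ := h
    exact ⟨_, by constructor, rfl⟩
  all_goals
    obtain ⟨rfl, rfl⟩ := h
    exact ⟨_, by constructor, rfl⟩
end Local
end ClaimRelease

/-! ### Moves as synchronisations of components -/

namespace ClaimRelease
open CSP Control
variable {P : Type}
section Local
variable [DecidableEq P] {users : Finset P} {max : ℕ} {p : P} {s s' : Shared P} {c c' : Control P}
  {l : Label (Event P)} {e : Event P} {T T' : Term P}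

/-- Outside the data events a user only performs its claim and release events and the `τ` left by an
inner termination. The data and the queue user are then not involved. -/
theorem move_of_silent (h : UserAct p c l c') (hl : ∀ e ∈ dataEvents (P := P), l ≠ .vis (.ev e))
    (s : Shared P) : Move p s c l s c' ∧ queueUserTerm p c' = queueUserTerm p c := by
  cases h
  case beginClaim | yielded | endClaim | claimed | beginRelease | scheduled | endRelease |
      released => exact ⟨by constructor, rfl⟩
  all_goals exact absurd rfl (hl _ (by simp [mem_dataEvents_iff, Event.IsQueueCall, Event.IsVar]))

/-- The variable determines the loaded value or the result of the CAS, and thereby selects one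
branch of the user. -/
theorem move_of_var (h : UserAct p c (.vis (.ev e)) c') (hs : VarStep s e s') :
    Move p s c .tau s' c' ∧ queueUserTerm p c' = queueUserTerm p c := by
  generalize hl : Label.vis (Obs.ev e) = l at h
  cases h <;> cases hl <;> cases hs
  case engage => exact ⟨.engage s, rfl⟩
  case reactivate => exact ⟨.reactivate s, rfl⟩
  case activate => exact ⟨.activate s, rfl⟩
  case storeOwner => exact ⟨.storeOwner s, rfl⟩
  case resume hs => exact ⟨.resume s hs.symm, rfl⟩
  case casNull hb =>
    subst hb
    by_cases hn : s.owner = none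
    · simpa [hn, queueUserTerm] using Move.casNull (p := p) s hn
    · simpa [hn, Ne.symm hn, queueUserTerm] using Move.casNullFail (p := p) s hn
  case loadOwner ho =>
    subst ho
    by_cases hn : s.owner = none
    · simpa [hn, queueUserTerm] using Move.loadNull (p := p) s hn
    by_cases hp : s.owner = some p
    · simpa [hp, queueUserTerm] using Move.loadSelf (p := p) s hp
    · simpa [hn, hp, queueUserTerm] using Move.loadOther (p := p) s hn hp
  case casFrom o b hb =>
    subst hb
    by_cases ho : o = s.owner
    · simpa [ho, queueUserTerm] using Move.casFrom (p := p) s _ rfl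
    · simpa [ho, queueUserTerm] using Move.casFromFail (p := p) s o ho
  case casNullAgain hb =>
    subst hb
    by_cases hn : s.owner = none
    · simpa [hn, queueUserTerm] using Move.casNullAgain (p := p) s hn
    · simpa [hn, Ne.symm hn, queueUserTerm] using Move.casNullAgainFail (p := p) s hn
  case wait hb =>
    subst hb
    by_cases hw : s.st p = .engaging
    · simpa [hw, queueUserTerm] using Move.wait (p := p) s hw
    · simpa [hw, Ne.symm hw, queueUserTerm] using Move.waitFail (p := p) s hw
  case casToNull hb =>
    by_cases ho : s.owner = some p
    · simpa [ho, queueUserTerm] using Move.casToNull (p := p) s ho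
    · simpa [ho, Ne.symm ho, queueUserTerm] using Move.casToNullFail (p := p) s ho
  case casTo h b hb =>
    subst hb
    by_cases ho : s.owner = some p
    · simpa [ho, queueUserTerm] using Move.casTo (p := p) s h ho
    · simpa [ho, Ne.symm ho, queueUserTerm] using Move.casToFail (p := p) s h ho
  case schedule h b hb =>
    subst hb
    by_cases hw : s.st h = .engaging
    · simpa [hw, queueUserTerm] using Move.schedule (p := p) s h hw
    · simpa [hw, Ne.symm hw, queueUserTerm] using Move.scheduleFail (p := p) s h hw
  case scheduleWaiter h b hb =>
    by_cases hw : s.st h = .waiting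
    · simpa [hw, queueUserTerm] using Move.scheduleWaiter (p := p) s h hw
    · simpa [hw, Ne.symm hw, queueUserTerm] using Move.scheduleWaiterFail (p := p) s h hw

/-- The user process would accept a return even before the call is linearized, but the queue user
then offers only the linearization event. Once linearized, the queue user dictates the returned
value. -/
theorem move_of_queue (h : UserAct p c (.vis (.ev e)) c') (he : e.IsQueueCall)
    (hT : Step (definitions users max) (queueUserTerm p c) (.vis (.ev e)) T) (s : Shared P) :
    ∃ c'', Move p s c .tau s c'' ∧ T = queueUserTerm p c'' ∧ userTerm p c'' = userTerm p c' := by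
  cases h
  case ret w v =>
    simp only [queueUserTerm, step_pre_iff] at hT
    obtain ⟨hv, rfl⟩ := hT
    cases hv
    split_ifs with hw
    · subst hw
      exact ⟨_, .peekedSelf s, rfl, rfl⟩
    · exact ⟨_, .peekedOther s _ hw, rfl, rfl⟩
  case next w v =>
    simp only [queueUserTerm, step_pre_iff] at hT
    obtain ⟨hv, rfl⟩ := hT
    cases hv
    cases w with
    | none => exact ⟨_, .nextNull s, rfl, rfl⟩
    | some h => exact ⟨_, .next s h, rfl, rfl⟩
  case dequeued w =>
    simp only [queueUserTerm, step_pre_iff] at hT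
    obtain ⟨hv, rfl⟩ := hT
    cases hv
    exact ⟨_, .dequeued s, rfl, rfl⟩
  all_goals
    simp [queueUserTerm, step_call_iff, definitions, queueUserBody, Event.IsQueueCall] at hT he
  all_goals subst hT
  case enqueue => exact ⟨_, .enqueue s, rfl, rfl⟩
  case endEnqueue => exact ⟨_, .endEnqueue s, rfl, rfl⟩
  case peek => exact ⟨_, .peek s, rfl, rfl⟩
  case dequeue => exact ⟨_, .dequeue s, rfl, rfl⟩
  case peekNext => exact ⟨_, .peekNext s, rfl, rfl⟩

/-- Linearization is invisible to the user: control states before and after it, such as `enqueuing`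
and `enqueued`, differ only in the queue user. -/
theorem move_of_lin (hs : QueueStep s e s')
    (hT : Step (definitions users max) (queueUserTerm p c) (.vis (.ev e)) T) :
    ∃ c', Move p s c .tau s' c' ∧ T = queueUserTerm p c' ∧ userTerm p c' = userTerm p c := by
  cases hs <;> cases c <;>
    simp [queueUserTerm, step_call_iff, definitions, queueUserBody] at hT
  case linEnqueue.enqueuing =>
    obtain ⟨⟨rfl, rfl⟩, rfl⟩ := hT
    exact ⟨_, .linEnqueue s, rfl, rfl⟩
  all_goals obtain ⟨rfl, rfl⟩ := hT
  case linDequeue.dequeuing => exact ⟨_, .linDequeue s, rfl, rfl⟩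
  case linPeek.peeking => exact ⟨_, .linPeek s, rfl, rfl⟩
  case linPeek.peekingNext => exact ⟨_, .linPeekNext s, rfl, rfl⟩

/-- The steps of the components in which a move of a user consists. -/
theorem Move.components (users : Finset P) (max : ℕ) (h : Move p s c l s' c') :
    ((∀ e : Event P, e.IsQueueCall ∨ e.IsVar → l ≠ .vis (.ev e)) ∧ s' = s ∧
      Step (definitions users max) (userTerm p c) l (userTerm p c') ∧
      queueUserTerm p c' = queueUserTerm p c) ∨
    (l = .tau ∧ ∃ e, VarStep s e s' ∧
      Step (definitions users max) (userTerm p c) (.vis (.ev e)) (userTerm p c') ∧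
      queueUserTerm p c' = queueUserTerm p c) ∨
    (l = .tau ∧ s' = s ∧ ∃ e : Event P, e.IsQueueCall ∧
      Step (definitions users max) (userTerm p c) (.vis (.ev e)) (userTerm p c') ∧
      Step (definitions users max) (queueUserTerm p c) (.vis (.ev e)) (queueUserTerm p c')) ∨
    (l = .tau ∧ ∃ e, QueueStep s e s' ∧
      Step (definitions users max) (queueUserTerm p c) (.vis (.ev e)) (queueUserTerm p c') ∧
      userTerm p c' = userTerm p c) := by
  have var : ∀ {e c''}, UserAct p c (.vis (.ev e)) c'' → ∀ s'', VarStep s e s'' → s' = s'' →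
      c' = c'' → queueUserTerm p c' = queueUserTerm p c →
      ∃ e, VarStep s e s' ∧
        Step (definitions users max) (userTerm p c) (.vis (.ev e)) (userTerm p c') ∧
        queueUserTerm p c' = queueUserTerm p c := by
    rintro e c'' hu s'' hs rfl rfl hq
    exact ⟨e, hs, hu.step, hq⟩
  have call : ∀ {e c''}, UserAct p c (.vis (.ev e)) c'' → e.IsQueueCall → s' = s → c' = c'' →
      Step (definitions users max) (queueUserTerm p c) (.vis (.ev e)) (queueUserTerm p c') →
      Label.tau (E := Event P) = .tau ∧ s' = s ∧ ∃ e : Event P, e.IsQueueCall ∧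
        Step (definitions users max) (userTerm p c) (.vis (.ev e)) (userTerm p c') ∧
        Step (definitions users max) (queueUserTerm p c) (.vis (.ev e)) (queueUserTerm p c') := by
    rintro e c'' hu he rfl rfl hq
    exact ⟨rfl, rfl, e, he, hu.step, hq⟩
  cases h
  case beginClaim | yielded | endClaim | claimed | beginRelease | scheduled | endRelease |
      released =>
    refine .inl ⟨fun e he => ?_, rfl, UserAct.step (by constructor), rfl⟩
    rintro ⟨⟩ <;> simp [Event.IsQueueCall, Event.IsVar] at he
  case linEnqueue =>
    exact .inr (.inr (.inr ⟨rfl, _, .linEnqueue s p p, by simp [queueUserTerm], rfl⟩))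
  case linDequeue =>
    exact .inr (.inr (.inr ⟨rfl, _, .linDequeue s p, by simp [queueUserTerm], rfl⟩))
  case linPeek | linPeekNext =>
    exact .inr (.inr (.inr ⟨rfl, _, .linPeek s p, by simp [queueUserTerm], rfl⟩))
  case enqueue =>
    exact .inr <| .inr <| .inl <| call .enqueue trivial rfl rfl (by
      simp [queueUserTerm, step_call_iff, definitions, queueUserBody])
  case peek =>
    exact .inr <| .inr <| .inl <| call .peek trivial rfl rfl (by
      simp [queueUserTerm, step_call_iff, definitions, queueUserBody])
  case dequeue =>
    exact .inr <| .inr <| .inl <| call .dequeue trivial rfl rfl (by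
      simp [queueUserTerm, step_call_iff, definitions, queueUserBody])
  case peekNext =>
    exact .inr <| .inr <| .inl <| call .peekNext trivial rfl rfl (by
      simp [queueUserTerm, step_call_iff, definitions, queueUserBody])
  case endEnqueue =>
    exact .inr <| .inr <| .inl <| call .endEnqueue trivial rfl rfl (by simp [queueUserTerm])
  case dequeued =>
    exact .inr <| .inr <| .inl <| call (.dequeued _) trivial rfl rfl (by simp [queueUserTerm])
  case peekedSelf =>
    exact .inr <| .inr <| .inl <| call (.ret _ (some p)) trivial rfl (by simp)
      (by simp [queueUserTerm])
  case peekedOther v hv =>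
    exact .inr <| .inr <| .inl <| call (.ret _ v) trivial rfl (by simp [hv])
      (by simp [queueUserTerm])
  case nextNull =>
    exact .inr <| .inr <| .inl <| call (.next _ none) trivial rfl rfl (by simp [queueUserTerm])
  case next h =>
    exact .inr <| .inr <| .inl <| call (.next _ (some h)) trivial rfl rfl (by simp [queueUserTerm])
  all_goals refine .inr (.inl ⟨rfl, ?_⟩)
  case engage => exact var .engage _ (.storeState s _ _) rfl rfl rfl
  case reactivate => exact var .reactivate _ (.storeState s _ _) rfl rfl rfl
  case activate => exact var .activate _ (.storeState s _ _) rfl rfl rfl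
  case storeOwner => exact var .storeOwner _ (.storeOwner s _) rfl rfl rfl
  case resume hs => exact var .resume _ (.loadState s _ _ hs.symm) rfl rfl rfl
  case casNull hn =>
    exact var (.casNull true) _ (.casOwner s _ _ _ (by simp [hn])) (by simp [hn]) rfl rfl
  case casNullFail hn =>
    exact var (.casNull false) _ (.casOwner s _ _ _ (by simp [Ne.symm hn]))
      (by simp [Ne.symm hn]) rfl rfl
  case loadNull hn => exact var (.loadOwner none) _ (.loadOwner s _ hn.symm) rfl (by simp) rfl
  case loadSelf hp => exact var (.loadOwner (some p)) _ (.loadOwner s _ hp.symm) rfl (by simp) rfl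
  case loadOther hn hp =>
    exact var (.loadOwner s.owner) _ (.loadOwner s _ rfl) rfl (by simp [hn, hp]) rfl
  case casFrom o ho =>
    exact var (.casFrom o true) _ (.casOwner s _ _ _ (by simp [ho])) (by simp [ho]) rfl rfl
  case casFromFail o ho =>
    exact var (.casFrom o false) _ (.casOwner s _ _ _ (by simp [ho])) (by simp [ho]) rfl rfl
  case casNullAgain hn =>
    exact var (.casNullAgain true) _ (.casOwner s _ _ _ (by simp [hn])) (by simp [hn]) rfl rfl
  case casNullAgainFail hn =>
    exact var (.casNullAgain false) _ (.casOwner s _ _ _ (by simp [Ne.symm hn]))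
      (by simp [Ne.symm hn]) rfl rfl
  case wait hw =>
    exact var (.wait true) _ (.casState s _ _ _ _ (by simp [hw])) (by simp [hw]) rfl rfl
  case waitFail hw =>
    exact var (.wait false) _ (.casState s _ _ _ _ (by simp [Ne.symm hw]))
      (by simp [Ne.symm hw]) rfl rfl
  case casToNull hn =>
    exact var (.casToNull true) _ (.casOwner s _ _ _ (by simp [hn])) (by simp [hn]) rfl rfl
  case casToNullFail hn =>
    exact var (.casToNull false) _ (.casOwner s _ _ _ (by simp [Ne.symm hn]))
      (by simp [Ne.symm hn]) rfl rfl
  case casTo h hn =>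
    exact var (.casTo h true) _ (.casOwner s _ _ _ (by simp [hn])) (by simp [hn]) rfl rfl
  case casToFail h hn =>
    exact var (.casTo h false) _ (.casOwner s _ _ _ (by simp [Ne.symm hn]))
      (by simp [Ne.symm hn]) rfl rfl
  case schedule h hw =>
    exact var (.schedule h true) _ (.casState s _ _ _ _ (by simp [hw])) (by simp [hw]) rfl rfl
  case scheduleFail h hw =>
    exact var (.schedule h false) _ (.casState s _ _ _ _ (by simp [Ne.symm hw]))
      (by simp [Ne.symm hw]) rfl rfl
  case scheduleWaiter h hw =>
    exact var (.scheduleWaiter h true) _ (.casState s _ _ _ _ (by simp [hw])) (by simp [hw]) rfl rfl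
  case scheduleWaiterFail h hw =>
    exact var (.scheduleWaiter h false) _ (.casState s _ _ _ _ (by simp [Ne.symm hw]))
      (by simp [Ne.symm hw]) rfl rfl

end Local
end ClaimRelease

/-! ### Assembling the implementation from its components -/

namespace ClaimRelease
open CSP Control
variable {P : Type}
section Global
variable [DecidableEq P] {users : Finset P} {max : ℕ} {s s' : Shared P} {pc : P → Control P}
  {l : Label (Event P)} {e : Event P} {T : Term P}

/-- The shared variables. -/
def varTerm (s : Shared P) : Term P :=
  .par ∅ (.interleave fun p : P => .call (.stateVar p (s.st p))) (.call (.ownerVar s.owner))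

/-- The queue. -/
def queueTerm (users : Finset P) (s : Shared P) (pc : P → Control P) : Term P :=
  .hide (.par queueSync (.interleave fun u : users => queueUserTerm u.1 (pc u.1))
    (.call (.queueSpec s.q))) queueLin

/-- The implementation. -/
def implTerm (users : Finset P) (s : Shared P) (pc : P → Control P) : Term P :=
  .hide (.par dataEvents (.par ∅ (queueTerm users s pc) (varTerm s))
    (.interleave fun u : users => userTerm u.1 (pc u.1))) dataEvents

/-- The initial values of the shared data. -/
def Shared.init : Shared P := ⟨none, fun _ => .active, []⟩

theorem ownerVar_step_iff {v : Option P} :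
    Step (definitions users max) (.call (.ownerVar v)) l T ↔
      (l = .vis (.ev (.owner .load v)) ∧ T = .call (.ownerVar v)) ∨
      (∃ w, l = .vis (.ev (.owner .store w)) ∧ T = .call (.ownerVar w)) ∨
      ∃ x y, l = .vis (.ev (.ownerCas x y (decide (x = v)))) ∧
        T = .call (.ownerVar (if x = v then y else v)) := by
  simp only [step_call_iff, definitions, atomicVariable, step_extChoice_iff, step_pre_iff,
    step_input_iff, Prod.exists, apply_ite Name.ownerVar, apply_ite Proc.call]
  constructor
  · rintro (⟨-, h | ⟨-, h⟩ | ⟨rfl, h⟩⟩ | ⟨rfl, h⟩)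
    · exact .inl h
    · exact .inr h
    · simp at h
    · simp at h
  · have hl : ∀ {e : Event P}, l = .vis (.ev e) → l ≠ .tau := by rintro e rfl; nofun
    rintro (h | ⟨w, h⟩ | ⟨x, y, h⟩)
    · exact .inl ⟨hl h.1, .inl h⟩
    · exact .inl ⟨hl h.1, .inr (.inl ⟨hl h.1, .inl ⟨w, h⟩⟩)⟩
    · exact .inl ⟨hl h.1, .inr (.inl ⟨hl h.1, .inr ⟨x, y, h⟩⟩)⟩

theorem stateVar_step_iff {p : P} {v : UState} :
    Step (definitions users max) (.call (.stateVar p v)) l T ↔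
      (l = .vis (.ev (.state .load p v)) ∧ T = .call (.stateVar p v)) ∨
      (∃ w, l = .vis (.ev (.state .store p w)) ∧ T = .call (.stateVar p w)) ∨
      ∃ x y, l = .vis (.ev (.casState p x y (decide (x = v)))) ∧
        T = .call (.stateVar p (if x = v then y else v)) := by
  simp only [step_call_iff, definitions, atomicVariable, step_extChoice_iff, step_pre_iff,
    step_input_iff, Prod.exists, apply_ite (Name.stateVar p), apply_ite Proc.call]
  constructor
  · rintro (⟨-, h | ⟨-, h⟩ | ⟨rfl, h⟩⟩ | ⟨rfl, h⟩)
    · exact .inl h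
    · exact .inr h
    · simp at h
    · simp at h
  · have hl : ∀ {e : Event P}, l = .vis (.ev e) → l ≠ .tau := by rintro e rfl; nofun
    rintro (h | ⟨w, h⟩ | ⟨x, y, h⟩)
    · exact .inl ⟨hl h.1, .inl h⟩
    · exact .inl ⟨hl h.1, .inr (.inl ⟨hl h.1, .inl ⟨w, h⟩⟩)⟩
    · exact .inl ⟨hl h.1, .inr (.inl ⟨hl h.1, .inr ⟨x, y, h⟩⟩)⟩

theorem ownerVar_noTick {v : Option P} :
    NoTick (definitions users max) (.call (.ownerVar v)) :=
  ⟨nofun, fun T h => by simp [ownerVar_step_iff] at h⟩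

theorem stateVar_noTick {p : P} {v : UState} :
    NoTick (definitions users max) (.call (.stateVar p v)) :=
  ⟨nofun, fun T h => by simp [stateVar_step_iff] at h⟩

theorem varTerm_noTick [Nonempty P] : NoTick (definitions users max) (varTerm s) :=
  (NoTick.interleave fun _ => stateVar_noTick).par ownerVar_noTick

theorem update_dependent {ι : Type} [DecidableEq ι] {α β : Type*} (g : ι → α → β) (f : ι → α)
    (i : ι) (a : α) :
    Function.update (fun j => g j (f j)) i (g i a) = fun j => g j (Function.update f i a j) := by
  funext j
  by_cases h : j = i
  · subst h; simp
  · simp [h]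

/-- Translates an update of one component process into an update of the control state of one user.
Processes are indexed by the subtype of users, control states by all identifiers. -/
theorem update_val {α : Type} {β : Type*} (g : P → α → β) (f : P → α) (u : users) (a : α) :
    Function.update (fun v : users => g v.1 (f v.1)) u (g u.1 a) =
      fun v : users => g v.1 (Function.update f u.1 a v.1) := by
  funext v
  by_cases h : v = u
  · subst h; simp
  · simp [h, Subtype.coe_ne_coe.2 h]

theorem varTerm_step_iff [Nonempty P] :
    Step (definitions users max) (varTerm s) l T ↔
      ∃ e s', l = .vis (.ev e) ∧ VarStep s e s' ∧ T = varTerm s' := by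
  -- Every step of a state variable is treated as an update; a load writes back the present value.
  have hst : ∀ p v, (.par ∅ (.interleave (Function.update
        (fun p : P => (.call (.stateVar p (s.st p)) : Term P)) p (.call (.stateVar p v))))
        (.call (.ownerVar s.owner)) : Term P) =
      varTerm { s with st := Function.update s.st p v } := fun p v => by
    rw [varTerm, update_dependent (fun p v => (.call (.stateVar p v) : Term P))]
  rw [varTerm, step_par_iff (NoTick.interleave fun _ => stateVar_noTick) ownerVar_noTick]
  simp only [step_interleave_iff (fun _ => stateVar_noTick), Set.mem_empty_iff_false,
    stateVar_step_iff, ownerVar_step_iff]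
  constructor
  · rintro (⟨-, ⟨_, ⟨p, _, (⟨rfl, rfl⟩ | ⟨w, rfl, rfl⟩ | ⟨x, y, rfl, rfl⟩), rfl⟩, rfl⟩ |
      ⟨_, (⟨rfl, rfl⟩ | ⟨w, rfl, rfl⟩ | ⟨x, y, rfl, rfl⟩), rfl⟩⟩ | ⟨_, ⟨⟩, _⟩)
    · exact ⟨_, _, rfl, .loadState s p _ rfl, by rw [hst, Function.update_eq_self]⟩
    · exact ⟨_, _, rfl, .storeState s p w, hst _ _⟩
    · exact ⟨_, _, rfl, .casState s p x y _ rfl, hst _ _⟩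
    · exact ⟨_, _, rfl, .loadOwner s _ rfl, rfl⟩
    · exact ⟨_, _, rfl, .storeOwner s w, rfl⟩
    · exact ⟨_, _, rfl, .casOwner s x y _ rfl, rfl⟩
  · rintro ⟨e, s', rfl, hs, rfl⟩
    refine .inl ⟨nofun, ?_⟩
    cases hs with
    | loadState p v hv =>
      subst hv
      exact .inl ⟨_, ⟨p, _, .inl ⟨rfl, rfl⟩, rfl⟩, by rw [hst, Function.update_eq_self]⟩
    | storeState p v => exact .inl ⟨_, ⟨p, _, .inr (.inl ⟨v, rfl, rfl⟩), rfl⟩, (hst _ _).symm⟩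
    | casState p x y b hb =>
      subst hb
      exact .inl ⟨_, ⟨p, _, .inr (.inr ⟨x, y, rfl, rfl⟩), rfl⟩, (hst _ _).symm⟩
    | loadOwner v hv => subst hv; exact .inr ⟨_, .inl ⟨rfl, rfl⟩, rfl⟩
    | storeOwner v => exact .inr ⟨_, .inr (.inl ⟨v, rfl, rfl⟩), rfl⟩
    | casOwner x y b hb => subst hb; exact .inr ⟨_, .inr (.inr ⟨x, y, rfl, rfl⟩), rfl⟩

/-- No bound on the length is needed in this direction, because an overfull queue has no steps at
all. -/
theorem queueSpec_step (h : Step (definitions users max) (.call (.queueSpec s.q)) l T) :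
    ∃ e, l = .vis (.ev e) ∧ ((e.IsQueueCall ∧ T = .call (.queueSpec s.q)) ∨
      ∃ s', QueueStep s e s' ∧ T = .call (.queueSpec s'.q)) := by
  by_cases hq : s.q.length ≤ max
  swap
  · simp [step_call_iff, definitions, queueSpecBody, Proc.guarded, hq] at h
  simp only [step_call_iff, definitions, queueSpecBody, Proc.guarded, hq, if_true] at h
  cases l with
  | tau => cases hs : s.q <;> simp [hs, -step_extChoice_iff, step_extChoice_tau_iff] at h
  | vis o =>
  cases hs : s.q <;> simp [hs, -step_extChoice_iff, step_extChoice_vis_iff] at h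
  case nil =>
    rcases h with ⟨⟨a, b, rfl⟩, rfl⟩ | ⟨a, b, rfl, rfl⟩ | ⟨⟨a, rfl⟩, rfl⟩ | ⟨⟨a, rfl⟩, rfl⟩ |
      ⟨⟨a, rfl⟩, rfl⟩ | ⟨⟨a, rfl⟩, rfl⟩ | ⟨⟨a, rfl⟩, rfl⟩ | ⟨⟨a, b, rfl⟩, rfl⟩
    · exact ⟨_, rfl, .inl ⟨trivial, rfl⟩⟩
    · exact ⟨_, rfl, .inr ⟨_, .linEnqueue s a b, by simp [hs]⟩⟩
    · exact ⟨_, rfl, .inl ⟨trivial, rfl⟩⟩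
    · exact ⟨_, rfl, .inl ⟨trivial, rfl⟩⟩
    · exact ⟨_, rfl, .inr ⟨_, by simpa [hs] using QueueStep.linDequeue s a, rfl⟩⟩
    · exact ⟨_, rfl, .inl ⟨trivial, rfl⟩⟩
    · exact ⟨_, rfl, .inr ⟨_, by simpa [hs] using QueueStep.linPeek s a, by simp [hs]⟩⟩
    · exact ⟨_, rfl, .inl ⟨trivial, rfl⟩⟩
  case cons x t =>
    rcases h with ⟨⟨a, b, rfl⟩, rfl⟩ | ⟨a, b, rfl, rfl⟩ | ⟨⟨a, rfl⟩, rfl⟩ | ⟨⟨a, rfl⟩, rfl⟩ |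
      ⟨⟨a, rfl⟩, rfl⟩ | ⟨⟨a, rfl⟩, rfl⟩ | ⟨⟨a, rfl⟩, rfl⟩ | ⟨⟨a, b, rfl⟩, rfl⟩
    · exact ⟨_, rfl, .inl ⟨trivial, rfl⟩⟩
    · exact ⟨_, rfl, .inr ⟨_, .linEnqueue s a b, by simp [hs]⟩⟩
    · exact ⟨_, rfl, .inl ⟨trivial, rfl⟩⟩
    · exact ⟨_, rfl, .inl ⟨trivial, rfl⟩⟩
    · exact ⟨_, rfl, .inr ⟨_, by simpa [hs] using QueueStep.linDequeue s a, rfl⟩⟩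
    · exact ⟨_, rfl, .inl ⟨trivial, rfl⟩⟩
    · exact ⟨_, rfl, .inr ⟨_, by simpa [hs] using QueueStep.linPeek s a, by simp [hs]⟩⟩
    · exact ⟨_, rfl, .inl ⟨trivial, rfl⟩⟩

theorem queueSpec_step_call (hq : s.q.length ≤ max) (he : e.IsQueueCall) :
    Step (definitions users max) (.call (.queueSpec s.q)) (.vis (.ev e)) (.call (.queueSpec s.q)) := by
  simp only [step_call_iff, definitions, queueSpecBody, Proc.guarded, hq, if_true]
  cases e <;> simp only [Event.IsQueueCall] at he <;> cases s.q <;>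
    simp [-step_extChoice_iff, step_extChoice_vis_iff]

theorem QueueStep.queueSpec_step (hq : s.q.length ≤ max) (hs : QueueStep s e s') :
    Step (definitions users max) (.call (.queueSpec s.q)) (.vis (.ev e))
      (.call (.queueSpec s'.q)) := by
  simp only [step_call_iff, definitions, queueSpecBody, Proc.guarded, hq, if_true]
  cases hs <;> cases s.q <;> simp [-step_extChoice_iff, step_extChoice_vis_iff]

theorem VarStep.isVar (h : VarStep s e s') : e.IsVar := by cases h <;> trivial

omit [DecidableEq P] in
theorem QueueStep.isQueueLin (h : QueueStep s e s') : e.IsQueueLin := by cases h <;> trivial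

theorem VarStep.q_eq (h : VarStep s e s') : s'.q = s.q := by cases h <;> rfl

omit [DecidableEq P] in
theorem varTerm_congr (h : QueueStep s e s') : varTerm s' = varTerm s := by cases h <;> rfl

theorem queueTerm_congr {p : P} {c' : Control P} (hq : s'.q = s.q)
    (hc : queueUserTerm p c' = queueUserTerm p (pc p)) :
    queueTerm users s' (Function.update pc p c') = queueTerm users s pc := by
  rw [queueTerm, queueTerm, hq]
  congr 3
  funext u
  by_cases h : u.1 = p
  · subst h; simp [hc]
  · simp [h]

/-- The process that performs a call to the queue. -/
def Event.caller : Event P → Option P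
  | enqueue p _ | dequeue p | peek p | endEnqueue p | ret p _ => some p
  | _ => none

/-- Every call event names its caller. With `queueUserTerm_caller` this forces a user process to
synchronise with its own queue user. -/
theorem UserAct.caller {p : P} {c c' : Control P} (h : UserAct p c (.vis (.ev e)) c')
    (he : e.IsQueueCall) : e.caller = some p := by
  cases h <;> first | rfl | cases he

theorem queueUserTerm_caller {p : P} {c : Control P} (he : e.IsQueueCall)
    (h : Step (definitions users max) (queueUserTerm p c) (.vis (.ev e)) T) :
    e.caller = some p := by
  cases c <;> simp [queueUserTerm, step_call_iff, definitions, queueUserBody] at h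
  all_goals grind [Event.IsQueueCall, Event.caller]

theorem queueUserTerm_event {p : P} {c : Control P}
    (h : Step (definitions users max) (queueUserTerm p c) l T) :
    ∃ e, l = .vis (.ev e) ∧ (e.IsQueueCall ∨ e.IsQueueLin) := by
  cases c <;> simp [queueUserTerm, step_call_iff, definitions, queueUserBody] at h
  all_goals grind [Event.IsQueueCall, Event.IsQueueLin]

theorem queueUsers_event [Nonempty users]
    (h : Step (definitions users max)
      (.interleave fun u : users => queueUserTerm u.1 (pc u.1)) l T) :
    ∃ e ∈ queueSync, l = .vis (.ev e) := by
  obtain ⟨u, T', h, -⟩ := (step_interleave_iff fun _ => queueUserTerm_noTick).1 h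
  obtain ⟨e, rfl, he⟩ := queueUserTerm_event h
  exact ⟨e, mem_queueSync_iff.2 he, rfl⟩

theorem queueSpec_event (h : Step (definitions users max) (.call (.queueSpec s.q)) l T) :
    ∃ e ∈ queueSync, l = .vis (.ev e) := by
  obtain ⟨e, rfl, ⟨he, -⟩ | ⟨s', hs, -⟩⟩ := queueSpec_step h
  · exact ⟨e, mem_queueSync_iff.2 (.inl he), rfl⟩
  · exact ⟨e, mem_queueSync_iff.2 (.inr hs.isQueueLin), rfl⟩

omit [DecidableEq P] in
theorem Event.IsQueueCall.not_isQueueLin {e : Event P} (h : e.IsQueueCall) : ¬ e.IsQueueLin := by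
  cases e <;> simp_all [Event.IsQueueCall, Event.IsQueueLin]

/-- Several control states share one queue-user process, so the queue alone does not determine the
new control state. It is left open as `c'` and supplied once the user process is known. -/
theorem queueTerm_step [Nonempty users]
    (h : Step (definitions users max) (queueTerm users s pc) l T) :
    ∃ e s', ((l = .vis (.ev e) ∧ e.IsQueueCall ∧ s' = s) ∨ (l = .tau ∧ QueueStep s e s')) ∧
      ∃ (u : users) (T' : Term P),
        Step (definitions users max) (queueUserTerm u.1 (pc u.1)) (.vis (.ev e)) T' ∧
        ∀ c', T' = queueUserTerm u.1 c' → T = queueTerm users s' (Function.update pc u.1 c') := by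
  obtain ⟨e, he, hl, P', Q', hP, hQ, rfl⟩ :=
    (step_hide_sync_iff queueUsers_event nofun queueSpec_event nofun).1 h
  obtain ⟨u, T', hu, rfl⟩ := (step_interleave_iff fun _ => queueUserTerm_noTick).1 hP
  have hT : ∀ q c', T' = queueUserTerm u.1 c' → (.hide (.par queueSync (.interleave
      (Function.update (fun u : users => queueUserTerm u.1 (pc u.1)) u T'))
        (.call (.queueSpec q))) queueLin : Term P) =
      queueTerm users { s with q := q } (Function.update pc u.1 c') := by
    rintro q c' rfl
    rw [queueTerm, update_val (fun p c => queueUserTerm p c)]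
  obtain ⟨_, ⟨⟩, ⟨he', rfl⟩ | ⟨s', hs, rfl⟩⟩ := queueSpec_step hQ
  · refine ⟨e, s, ?_, u, T', hu, hT s.q⟩
    rcases hl with ⟨-, rfl⟩ | ⟨hB, -⟩
    · exact .inl ⟨rfl, he', rfl⟩
    · exact absurd (mem_queueLin_iff.1 hB) he'.not_isQueueLin
  · refine ⟨e, s', ?_, u, T', hu, hT s'.q⟩
    rcases hl with ⟨hB, rfl⟩ | ⟨hB, rfl⟩
    · exact absurd (mem_queueLin_iff.2 hs.isQueueLin) hB
    · exact .inr ⟨rfl, hs⟩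

theorem queueTerm_step_call {p : P} {c' : Control P} (hp : p ∈ users) (hq : s.q.length ≤ max)
    (he : e.IsQueueCall)
    (h : Step (definitions users max) (queueUserTerm p (pc p)) (.vis (.ev e))
      (queueUserTerm p c')) :
    Step (definitions users max) (queueTerm users s pc) (.vis (.ev e))
      (queueTerm users s (Function.update pc p c')) := by
  have : Nonempty users := ⟨⟨p, hp⟩⟩
  refine (step_hide_sync_iff queueUsers_event nofun queueSpec_event nofun).2
    ⟨e, mem_queueSync_iff.2 (.inl he), .inl ⟨?_, rfl⟩, _, _,
      (step_interleave_iff fun _ => queueUserTerm_noTick).2 ⟨⟨p, hp⟩, _, h, rfl⟩,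
      queueSpec_step_call hq he, ?_⟩
  · exact fun hB => he.not_isQueueLin (mem_queueLin_iff.1 hB)
  · rw [queueTerm, ← update_val (fun p c => queueUserTerm p c) pc ⟨p, hp⟩]

theorem queueTerm_step_lin {p : P} {c' : Control P} (hp : p ∈ users) (hq : s.q.length ≤ max)
    (hs : QueueStep s e s')
    (h : Step (definitions users max) (queueUserTerm p (pc p)) (.vis (.ev e))
      (queueUserTerm p c')) :
    Step (definitions users max) (queueTerm users s pc) .tau
      (queueTerm users s' (Function.update pc p c')) := by
  have : Nonempty users := ⟨⟨p, hp⟩⟩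
  refine (step_hide_sync_iff queueUsers_event nofun queueSpec_event nofun).2
    ⟨e, mem_queueSync_iff.2 (.inr hs.isQueueLin), .inr ⟨?_, rfl⟩, _, _,
      (step_interleave_iff fun _ => queueUserTerm_noTick).2 ⟨⟨p, hp⟩, _, h, rfl⟩,
      hs.queueSpec_step hq, ?_⟩
  · exact mem_queueLin_iff.2 hs.isQueueLin
  · rw [queueTerm, ← update_val (fun p c => queueUserTerm p c) pc ⟨p, hp⟩]

theorem queueTerm_noTick [Nonempty users] :
    NoTick (definitions users max) (queueTerm users s pc) := by
  refine ⟨nofun, fun T h => ?_⟩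
  obtain ⟨e, s', ⟨⟨⟩, -⟩ | ⟨⟨⟩, -⟩, -⟩ := queueTerm_step h

theorem data_event [Nonempty users]
    (h : Step (definitions users max) (.par ∅ (queueTerm users s pc) (varTerm s)) (.vis (.ev e)) T) :
    e ∈ dataEvents := by
  have : Nonempty P := ‹Nonempty users›.map Subtype.val
  rcases (step_par_empty_iff queueTerm_noTick varTerm_noTick).1 h with ⟨P', h, -⟩ | ⟨Q', h, -⟩
  · obtain ⟨_, s', ⟨⟨⟩, he, -⟩ | ⟨⟨⟩, -⟩, -⟩ := queueTerm_step h
    exact mem_dataEvents_iff.2 (.inl he)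
  · obtain ⟨_, s', ⟨⟩, hs, -⟩ := varTerm_step_iff.1 h
    exact mem_dataEvents_iff.2 (.inr hs.isVar)

/-- The implementation is made up of the moves of the users. -/
theorem implTerm_step [Nonempty users]
    (hstep : Step (definitions users max) (implTerm users s pc) l T) :
    ∃ p ∈ users, ∃ s' c', Move p s (pc p) l s' c' ∧
      T = implTerm users s' (Function.update pc p c') := by
  have : Nonempty P := ‹Nonempty users›.map Subtype.val
  have hF : ∀ u : users, NoTick (definitions users max) (userTerm u.1 (pc u.1)) :=
    fun _ => userTerm_noTick
  have hd : NoTick (definitions users max) (.par ∅ (queueTerm users s pc) (varTerm s)) :=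
    queueTerm_noTick.par varTerm_noTick
  rcases (step_hide_server_iff hd (NoTick.interleave hF) data_event).1 hstep with
    ⟨rfl, _, hT, rfl⟩ | ⟨hn, _, hT, rfl⟩ | ⟨rfl, e, he, _, _, hT, hu, rfl⟩
  · rcases (step_par_empty_iff queueTerm_noTick varTerm_noTick).1 hT with
      ⟨P', h, rfl⟩ | ⟨Q', h, -⟩
    · obtain ⟨e, s', ⟨⟨⟩, -⟩ | ⟨-, hs⟩, u, T', hu, hT⟩ := queueTerm_step h
      obtain ⟨c', hm, rfl, hc⟩ := move_of_lin hs hu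
      refine ⟨u, u.2, s', c', hm, ?_⟩
      rw [implTerm, hT c' rfl, ← update_val userTerm, hc, Function.update_eq_self,
        varTerm_congr hs]
    · obtain ⟨_, s', ⟨⟩, -⟩ := varTerm_step_iff.1 h
  · obtain ⟨u, T', h, rfl⟩ := (step_interleave_iff hF).1 hT
    obtain ⟨c', hc, rfl⟩ := userAct_of_step h
    obtain ⟨hm, hq⟩ := move_of_silent hc hn s
    refine ⟨u, u.2, s, c', hm, ?_⟩
    rw [implTerm, queueTerm_congr rfl hq, ← update_val userTerm]
  · obtain ⟨u, T', huT, rfl⟩ := (step_interleave_iff hF).1 hu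
    obtain ⟨c', hc, rfl⟩ := userAct_of_step huT
    rcases (step_par_empty_iff queueTerm_noTick varTerm_noTick).1 hT with
      ⟨P', h, rfl⟩ | ⟨Q', h, rfl⟩
    · obtain ⟨_, s', ⟨⟨⟩, he', rfl⟩ | ⟨⟨⟩, -⟩, v, T', hv, hT⟩ := queueTerm_step h
      -- The user process and the queue user taking part in the call are both identified by the
      -- caller of the event.
      obtain rfl : u = v := by
        exact Subtype.ext <| Option.some_injective _ <|
          (hc.caller he').symm.trans (queueUserTerm_caller he' hv)
      obtain ⟨c'', hm, rfl, hcc⟩ := move_of_queue hc he' hv s'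
      refine ⟨u, u.2, s', c'', hm, ?_⟩
      rw [implTerm, hT c'' rfl, ← update_val userTerm, hcc]
    · obtain ⟨_, s', ⟨⟩, hs, rfl⟩ := varTerm_step_iff.1 h
      obtain ⟨hm, hq⟩ := move_of_var hc hs
      refine ⟨u, u.2, s', c', hm, ?_⟩
      rw [implTerm, queueTerm_congr hs.q_eq hq, ← update_val userTerm]

/-- The bound on the length opens the guard of the sequential queue, without which calls and
linearizations would be blocked. -/
theorem Move.implTerm_step {p : P} {c' : Control P} (hp : p ∈ users)
    (h : Move p s (pc p) l s' c') (hq : s.q.length ≤ max) :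
    Step (definitions users max) (implTerm users s pc) l
      (implTerm users s' (Function.update pc p c')) := by
  have : Nonempty users := ⟨⟨p, hp⟩⟩
  have : Nonempty P := ⟨p⟩
  have hF : ∀ u : users, NoTick (definitions users max) (userTerm u.1 (pc u.1)) :=
    fun _ => userTerm_noTick
  have hd : NoTick (definitions users max) (.par ∅ (queueTerm users s pc) (varTerm s)) :=
    queueTerm_noTick.par varTerm_noTick
  have huser : ∀ l, Step (definitions users max) (userTerm p (pc p)) l (userTerm p c') →
      Step (definitions users max) (.interleave fun u : users => userTerm u.1 (pc u.1)) l
        (.interleave fun u : users => userTerm u.1 (Function.update pc p c' u.1)) := fun l h => by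
    refine (step_interleave_iff hF).2 ⟨⟨p, hp⟩, _, h, ?_⟩
    rw [← update_val userTerm pc ⟨p, hp⟩]
  refine (step_hide_server_iff hd (NoTick.interleave hF) data_event).2 ?_
  rcases h.components users max with ⟨hn, rfl, hu, hqu⟩ | ⟨rfl, e, hs, hu, hqu⟩ |
    ⟨rfl, rfl, e, he, hu, hqu⟩ | ⟨rfl, e, hs, hqu, hu⟩
  · refine .inr (.inl ⟨fun e he => hn e (mem_dataEvents_iff.1 he), _, huser l hu, ?_⟩)
    rw [implTerm, queueTerm_congr rfl hqu]
  · refine .inr (.inr ⟨rfl, e, mem_dataEvents_iff.2 (.inr hs.isVar), _, _,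
      (step_par_empty_iff queueTerm_noTick varTerm_noTick).2
        (.inr ⟨_, varTerm_step_iff.2 ⟨e, s', rfl, hs, rfl⟩, rfl⟩), huser _ hu, ?_⟩)
    rw [implTerm, queueTerm_congr hs.q_eq hqu]
  · refine .inr (.inr ⟨rfl, e, mem_dataEvents_iff.2 (.inl he), _, _,
      (step_par_empty_iff queueTerm_noTick varTerm_noTick).2
        (.inl ⟨_, queueTerm_step_call hp hq he hqu, rfl⟩), huser _ hu, rfl⟩)
  · refine .inl ⟨rfl, _, (step_par_empty_iff queueTerm_noTick varTerm_noTick).2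
      (.inl ⟨_, queueTerm_step_lin hp hq hs hqu, rfl⟩), ?_⟩
    rw [implTerm, ← update_val userTerm pc ⟨p, hp⟩, hu, Function.update_eq_self, varTerm_congr hs]

end Global
end ClaimRelease

/-! ### The invariant of the implementation -/

namespace ClaimRelease
open CSP Control
variable {P : Type}

/-- The user is in the queue. -/
def Control.InQueue : Control P → Prop
  | enqueued | toPeek | peeking | peeked _ | casNull | loadOwner | storeOwner | casFrom _
  | casNullAgain | toWait | yielding | resuming | resumed | toActivate | toEndClaim | claimEnded
  | holding | toDequeue | dequeuing => True
  | _ => False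

/-- The user knows that the mutex has been granted to it. -/
def Control.Granted : Control P → Prop
  | resuming | resumed | toActivate | toEndClaim | claimEnded | holding | toDequeue
  | dequeuing => True
  | _ => False

/-- The user `p` has found itself at the head of the queue, and has not completed its claim. -/
def Control.SeenSelf (p : P) : Control P → Prop
  | peeked v => v = some p
  | casNull | loadOwner | storeOwner | casFrom _ | casNullAgain => True
  | _ => False

/-- If the user `p` is at the head of the queue, then it is going to find out by itself. -/
def Control.CanTake (p : P) : Control P → Prop
  | enqueued | toPeek | peeking => True
  | peeked v => v = some p
  | casNull | loadOwner | storeOwner | casFrom _ | casNullAgain => True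
  | _ => False

/-- The user is releasing the mutex, with `h` the current head of the queue, and will give up its
ownership. -/
def Control.Passing (h : Option P) : Control P → Prop
  | dequeued _ | toPeekNext | peekingNext => True
  | peekedNext (some x) | casTo x => h = some x
  | peekedNext none | casToNull => True
  | _ => False

/-- The user is releasing the mutex, and has seen an empty queue. -/
def Control.SeenEmpty : Control P → Prop
  | peekedNext none | casToNull => True
  | _ => False

/-- The user is going to schedule `h`. -/
def Control.Schedules (h : P) : Control P → Prop
  | scheduling x | schedulingWaiter x => x = h
  | _ => False

/-- The values of the state variable of a user that are compatible with its control state. -/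
def Control.Admits : Control P → UState → Prop
  | engaged, v | enqueuing, v => v = .engaging
  | enqueued, v | toPeek, v | peeking, v | peeked _, v | casNull, v | loadOwner, v | storeOwner, v
  | casFrom _, v | casNullAgain, v | toWait, v => v = .engaging ∨ v = .scheduled
  | yielding, v => v = .waiting ∨ v = .scheduled
  | resuming, v => v = .scheduled
  | resumed, v | toEndClaim, v | claimEnded, v | holding, v | toDequeue, v | dequeuing, v =>
      v ≠ .scheduled
  | _, _ => True

/-- The invariant of the implementation. -/
structure Inv (users : Finset P) (s : Shared P) (pc : P → Control P) : Prop where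
  idle_of_notMem : ∀ p, p ∉ users → pc p = idle
  nodup : s.q.Nodup
  mem_queue : ∀ p, p ∈ s.q ↔ (pc p).InQueue
  admits : ∀ p, (pc p).Admits (s.st p)
  granted : ∀ p, (pc p).Granted → s.q.head? = some p ∧ s.owner = some p
  scheduled : ∀ p, s.st p = .scheduled → s.q.head? = some p ∧ s.owner = some p
  seenSelf : ∀ p, (pc p).SeenSelf p → s.q.head? = some p
  -- Only the head of the queue turns NULL into an owner, so the unconditional store after reading
  -- NULL overwrites nobody.
  storeOwner : ∀ p, pc p = storeOwner → s.owner = none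
  -- Since `p` is the head, the owner it read is a releaser, which can only give up the ownership or
  -- pass it to `p`. After a failed CAS the owner is therefore NULL or `p`.
  casFrom : ∀ p o, pc p = casFrom o → o ≠ none ∧ o ≠ some p ∧
    (s.owner = o ∨ s.owner = none ∨ s.owner = some p)
  casNullAgain : ∀ p, pc p = casNullAgain → s.owner = none ∨ s.owner = some p
  dequeued : ∀ p v, pc p = dequeued v → v = some p
  schedules : ∀ p h, (pc p).Schedules h →
    s.q.head? = some h ∧ s.owner = some h ∧ ¬ (pc h).Granted ∧ s.st h ≠ .scheduled
  -- Once the CAS from ENGAGING has failed, the target is waiting and stays so until it is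
  -- scheduled; hence the CAS from WAITING succeeds.
  schedulingWaiter : ∀ p h, pc p = schedulingWaiter h → pc h = yielding
  schedules_unique : ∀ p p' h, (pc p).Schedules h → (pc p').Schedules h → p = p'
  -- An owner that is not being or has not been notified at the head is a releaser. The head it has
  -- seen is still correct, except that a queue seen empty may have filled meanwhile.
  owner : ∀ p, s.owner = some p → (s.q.head? = some p ∧
    ((pc p).Granted ∨ s.st p = .scheduled ∨ ∃ r, (pc r).Schedules p)) ∨
      (pc p).Passing s.q.head?
  -- This excludes lost wake-ups: in these situations no releaser will schedule the head, so the
  -- head must still be on its way to OWNER.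
  canTake : ∀ h, s.q.head? = some h →
    (s.owner = none ∨ ∃ r, s.owner = some r ∧ (pc r).SeenEmpty) → (pc h).CanTake h

variable [DecidableEq P] {users : Finset P} {s s' : Shared P} {pc : P → Control P}
  {l : Label (Event P)} {p : P} {c c' : Control P}

omit [DecidableEq P] in
theorem Inv.init : Inv users Shared.init (fun _ => idle) := by
  constructor <;> simp [Shared.init, InQueue, Admits, Granted, SeenSelf, Schedules]

-- This is what a scheduler may assume about its target: it is either still ENGAGING or already
-- WAITING in `yielding`, so one of the two CAS operations succeeds, and SCHEDULED is compatible
-- with its control state.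
omit [DecidableEq P] in
theorem Control.InQueue.admits_cases {c : Control P} {v : UState} (hq : c.InQueue)
    (hg : ¬ c.Granted) (ha : c.Admits v) (hv : v ≠ .scheduled) :
    c.Admits .scheduled ∧ (v = .engaging ∧ c ≠ yielding ∨ v = .waiting ∧ c = yielding) := by
  cases c <;> simp_all [InQueue, Granted, Admits]

omit [DecidableEq P] in
theorem Control.Granted.inQueue {c : Control P} (h : c.Granted) : c.InQueue := by
  cases c <;> simp_all [InQueue, Granted]

omit [DecidableEq P] in
theorem Control.CanTake.inQueue {c : Control P} (h : c.CanTake p) : c.InQueue := by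
  cases c <;> simp_all [InQueue, CanTake]

omit [DecidableEq P] in
theorem Control.SeenSelf.canTake {c : Control P} (h : c.SeenSelf p) : c.CanTake p := by
  cases c <;> simp_all [SeenSelf, CanTake]

omit [DecidableEq P] in
theorem Control.Passing.not_inQueue {c : Control P} {h : Option P} (hc : c.Passing h) :
    ¬ c.InQueue := by
  cases c <;> simp_all [InQueue, Passing]

omit [DecidableEq P] in
theorem Control.SeenEmpty.passing {c : Control P} {h : Option P} (hc : c.SeenEmpty) :
    c.Passing h := by
  match c, hc with
  | casToNull, _ => trivial
  | peekedNext none, _ => trivial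

/-- The moves that do not affect the other users preserve the invariant. -/
theorem Inv.move_local (hi : Inv users s pc) (hp : p ∈ users) (hc : pc p = c) {v : UState}
    (hq : c'.InQueue ↔ c.InQueue) (ha : c'.Admits v)
    (hv : v = .scheduled → s.st p = .scheduled)
    (hv' : s.st p = .scheduled → v = .scheduled ∨ c'.Granted)
    (hg : c'.Granted → c.Granted ∨ s.st p = .scheduled) (hg' : c.Granted → c'.Granted)
    (hs : c'.SeenSelf p → c.SeenSelf p ∨ s.q.head? = some p)
    (hso : c' = .storeOwner → s.owner = none)
    (hcf : ∀ o, c' = .casFrom o → o ≠ none ∧ o ≠ some p ∧ s.owner = o)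
    (hcn : c' = .casNullAgain → s.owner = none ∨ s.owner = some p)
    (hd : ∀ w, c' ≠ .dequeued w)
    (hsc : ∀ h, c'.Schedules h ↔ c.Schedules h)
    (hsw : ∀ h, c' = .schedulingWaiter h → pc h = .yielding)
    (hy : c = .yielding → s.st p = .scheduled)
    (hpass : s.owner = some p → c.Passing s.q.head? → c'.Passing s.q.head?)
    (hse : s.owner = some p → c'.SeenEmpty → c.SeenEmpty ∨ s.q.head? = none)
    (hct : c.CanTake p → s.q.head? = some p → c'.CanTake p ∨ s.owner = some p) :
    Inv users { s with st := Function.update s.st p v } (Function.update pc p c') := by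
  have hh : ∀ p, s.q.head? = some p → p ∈ s.q := fun _ => List.mem_of_mem_head?
  have hpq := hi.mem_queue p
  rw [hc] at hpq
  constructor <;> try simp only [Function.update_apply]
  case nodup => exact hi.nodup
  case idle_of_notMem => have := hi.idle_of_notMem; grind
  case mem_queue => have := hi.mem_queue; grind
  case admits => have := hi.admits; grind
  case granted => have := hi.granted; have := hi.scheduled; grind
  case scheduled => have := hi.scheduled; grind
  case seenSelf => have := hi.seenSelf; grind
  case storeOwner => have := hi.storeOwner; grind
  case casFrom => have := hi.casFrom; grind
  case casNullAgain => have := hi.casNullAgain; grind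
  case dequeued => have := hi.dequeued; grind
  case schedules => have := hi.schedules; grind
  case schedulingWaiter =>
    intro r h hr
    have hyield : pc h = yielding ∧ s.st h ≠ .scheduled := by
      by_cases hrp : r = p
      · rw [if_pos hrp] at hr
        refine ⟨hsw h hr, (hi.schedules p h ?_).2.2.2⟩
        rw [hc, ← hsc, hr]
        rfl
      · rw [if_neg hrp] at hr
        exact ⟨hi.schedulingWaiter r h hr, (hi.schedules r h (by simp [hr, Schedules])).2.2.2⟩
    -- The moving user is not `h`: a user in `yielding` moves only when scheduled, and `h` is not
    -- yet scheduled.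
    rw [if_neg, hyield.1]
    rintro rfl
    exact hyield.2 (hy (hc ▸ hyield.1))
  case schedules_unique => have := hi.schedules_unique; grind
  case owner =>
    intro r hr
    rcases hi.owner r hr with ⟨h1, h2 | h2 | ⟨r', h2⟩⟩ | h1 <;> grind
  case canTake =>
    rintro h hh' ho
    -- The premise already held before the move, because `p` cannot newly see an empty queue while
    -- `h` is at its head.
    have hpre : (s.owner = none ∨ ∃ r, s.owner = some r ∧ (pc r).SeenEmpty) := by
      refine ho.imp_right fun ⟨r, hr, he⟩ => ⟨r, hr, ?_⟩
      by_cases hrp : r = p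
      · subst hrp
        rw [if_pos rfl] at he
        rw [hc]
        exact (hse hr he).resolve_right (by simp [hh'])
      · rwa [if_neg hrp] at he
    have hct' := hi.canTake h hh' hpre
    by_cases hhp : h = p
    · subst hhp
      rw [hc] at hct'
      rw [if_pos rfl]
      -- If `p` were the owner, it would have seen an empty queue while releasing, and so would be
      -- outside the queue.
      refine (hct hct' hh').resolve_right fun hown => ?_
      obtain ⟨r, hr, he⟩ := hpre.resolve_left (by simp [hown])
      obtain rfl : h = r := by simpa [hown] using hr
      rw [hc] at he
      exact (he.passing (h := none)).not_inQueue hct'.inQueue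
    · rwa [if_neg hhp]

theorem Inv.move_control (hi : Inv users s pc) (hp : p ∈ users) (hc : pc p = c)
    (hq : c'.InQueue ↔ c.InQueue) (ha : c'.Admits (s.st p))
    (hg : c'.Granted → c.Granted ∨ s.st p = .scheduled) (hg' : c.Granted → c'.Granted)
    (hs : c'.SeenSelf p → c.SeenSelf p ∨ s.q.head? = some p)
    (hso : c' = .storeOwner → s.owner = none)
    (hcf : ∀ o, c' = .casFrom o → o ≠ none ∧ o ≠ some p ∧ s.owner = o)
    (hcn : c' = .casNullAgain → s.owner = none ∨ s.owner = some p)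
    (hd : ∀ w, c' ≠ .dequeued w)
    (hsc : ∀ h, c'.Schedules h ↔ c.Schedules h)
    (hsw : ∀ h, c' = .schedulingWaiter h → pc h = .yielding)
    (hy : c = .yielding → s.st p = .scheduled)
    (hpass : s.owner = some p → c.Passing s.q.head? → c'.Passing s.q.head?)
    (hse : s.owner = some p → c'.SeenEmpty → c.SeenEmpty ∨ s.q.head? = none)
    (hct : c.CanTake p → s.q.head? = some p → c'.CanTake p ∨ s.owner = some p) :
    Inv users s (Function.update pc p c') := by
  simpa using hi.move_local hp hc (v := s.st p) hq ha id .inl hg hg' hs hso hcf hcn hd hsc hsw hy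
    hpass hse hct

/-- The user at the head of the queue takes the ownership. -/
theorem Inv.move_take (hi : Inv users s pc) (hp : p ∈ users) (hs : (pc p).SeenSelf p)
    (ho : s.owner ≠ some p) :
    Inv users { s with owner := some p } (Function.update pc p toActivate) := by
  have hhead := hi.seenSelf p hs
  have hq := hs.canTake.inQueue
  obtain ⟨h1, h2, h3, h4, h5, h6, h7, h8, h9, h10, h11, h12, h13, h14, h15, h16⟩ := hi
  have h0 : ∀ p h, pc p = .schedulingWaiter h → (pc p).Schedules h := by grind [Schedules]
  constructor <;> try simp only [Function.update_apply]
  case canTake =>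
    -- The new owner is in the queue, so it cannot have seen it empty, and the clause holds
    -- vacuously.
    have := fun h : (toActivate : Control P).SeenEmpty => (h.passing (h := none)).not_inQueue
    grind [InQueue]
  all_goals first | assumption | grind [InQueue, Granted, SeenSelf, Schedules, Admits]

/-- The ownership is given up. -/
theorem Inv.move_casToNull (hi : Inv users s pc) (hp : p ∈ users) (hc : pc p = .casToNull)
    (ho : s.owner = some p) :
    Inv users { s with owner := none } (Function.update pc p toEndRelease) := by
  have hq : ¬ (pc p).InQueue := by simp [hc, InQueue]
  have hg : ¬ (pc p).Granted := by simp [hc, Granted]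
  have he : (pc p).SeenEmpty := by simp [hc, SeenEmpty]
  have hh : ∀ p, s.q.head? = some p → p ∈ s.q := fun _ => List.mem_of_mem_head?
  obtain ⟨h1, h2, h3, h4, h5, h6, h7, h8, h9, h10, h11, h12, h13, h14, h15, h16⟩ := hi
  have h0 : ∀ p h, pc p = .schedulingWaiter h → (pc p).Schedules h := by grind [Schedules]
  constructor <;> try simp only [Function.update_apply]
  all_goals first | assumption | grind [InQueue, Granted, SeenSelf, Schedules, Admits]

/-- The ownership is passed to the head of the queue. -/
theorem Inv.move_casTo (hi : Inv users s pc) (hp : p ∈ users) {h : P} (hc : pc p = .casTo h)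
    (ho : s.owner = some p) :
    Inv users { s with owner := some h } (Function.update pc p (scheduling h)) := by
  have hq : ¬ (pc p).InQueue := by simp [hc, InQueue]
  have hg : ¬ (pc p).Granted := by simp [hc, Granted]
  have hh : ∀ p, s.q.head? = some p → p ∈ s.q := fun _ => List.mem_of_mem_head?
  -- The releaser has left the queue, so its ownership falls under the second alternative of
  -- `owner`: the head it saw is still the head.
  have hhead : s.q.head? = some h := by
    rcases hi.owner p ho with ⟨h1, -⟩ | h1
    · exact absurd ((hi.mem_queue p).1 (hh p h1)) hq
    · simpa [hc, Passing] using h1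
  obtain ⟨h1, h2, h3, h4, h5, h6, h7, h8, h9, h10, h11, h12, h13, h14, h15, h16⟩ := hi
  have h0 : ∀ p h, pc p = .schedulingWaiter h → (pc p).Schedules h := by grind [Schedules]
  have h0' : ∀ x, (scheduling h).Schedules x ↔ h = x := fun x => Iff.rfl
  constructor <;> try simp only [Function.update_apply]
  case canTake =>
    have := fun h : (pc h).SeenEmpty => (h.passing (h := none)).not_inQueue
    grind [SeenEmpty]
  case owner =>
    have : p ≠ h := by grind
    intro r hr
    obtain rfl : h = r := by simpa using hr
    exact .inl ⟨hhead, .inr (.inr ⟨p, by simp [Schedules]⟩)⟩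
  all_goals first | assumption | grind [InQueue, Granted, SeenSelf, Admits]

/-- The new owner is scheduled. -/
theorem Inv.move_schedule (hi : Inv users s pc) (hp : p ∈ users) {h : P}
    (hs : (pc p).Schedules h) :
    Inv users { s with st := Function.update s.st h .scheduled }
      (Function.update pc p scheduleDone) := by
  obtain ⟨hhead, ho, hg, hst⟩ := hi.schedules p h hs
  have hq : ¬ (pc p).InQueue := by generalize pc p = c at hs; cases c <;> simp_all [Schedules, InQueue]
  have hpp : ¬ (pc p).Passing s.q.head? := by
    generalize pc p = c at hs; cases c <;> simp_all [Schedules, Passing]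
  have hh : ∀ p, s.q.head? = some p → p ∈ s.q := fun _ => List.mem_of_mem_head?
  -- The target may now become SCHEDULED without violating `admits`.
  have had := ((hi.mem_queue h).1 (hh h hhead)).admits_cases hg (hi.admits h) hst
  obtain ⟨h1, h2, h3, h4, h5, h6, h7, h8, h9, h10, h11, h12, h13, h14, h15, h16⟩ := hi
  have h0 : ∀ p h, pc p = .schedulingWaiter h → (pc p).Schedules h := by grind [Schedules]
  constructor <;> try simp only [Function.update_apply]
  case admits =>
    intro r
    have := h4 r
    have : p ≠ h := by grind
    grind [Admits]
  case canTake =>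
    have : ¬ (scheduleDone : Control P).SeenEmpty := id
    have := fun h : (pc h).SeenEmpty => (h.passing (h := none)).not_inQueue
    grind
  all_goals first | assumption | grind [InQueue, Granted, SeenSelf, Schedules]

/-- Appending changes the head only of an empty queue. The new head is then the enqueuing user,
which has yet to peek and so can still take the ownership itself. -/
theorem Inv.move_linEnqueue (hi : Inv users s pc) (hp : p ∈ users) (hc : pc p = enqueuing) :
    Inv users { s with q := s.q ++ [p] } (Function.update pc p enqueued) := by
  have hq : ¬ (pc p).InQueue := by simp [hc, InQueue]
  have hpn : p ∉ s.q := by rwa [hi.mem_queue]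
  have hh : ∀ p, s.q.head? = some p → p ∈ s.q := fun _ => List.mem_of_mem_head?
  have hadm : s.st p = .engaging := by simpa [hc, Admits] using hi.admits p
  have hhead : ∀ x, s.q.head? = some x → (s.q ++ [p]).head? = some x := by
    intro x hx; simp [hx]
  have hhead' : ∀ x, (s.q ++ [p]).head? = some x →
      s.q.head? = some x ∨ s.q.head? = none ∧ x = p := by
    intro x hx
    cases hq : s.q <;> simp_all
  have hpass : ∀ r, (pc r).Passing s.q.head? → (pc r).Passing (s.q ++ [p]).head? := by
    intro r
    generalize pc r = c
    -- The nested pattern splits `peekedNext` by the value seen, on which `Passing` depends.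
    rcases c with _ | _ | _ | _ | _ | _ | _ | _ | _ | _ | _ | _ | _ | _ | _ | _ | _ | _ | _ | _ |
      _ | _ | _ | _ | _ | _ | (_ | _) | _ | _ | _ <;> simp +contextual [Passing]
  have hnodup : (s.q ++ [p]).Nodup := by
    simpa [List.nodup_append, hi.nodup] using fun a ha => (ne_of_mem_of_not_mem ha hpn)
  have hmem : ∀ r, r ∈ s.q ++ [p] ↔ r ∈ s.q ∨ r = p := by simp
  obtain ⟨h1, h2, h3, h4, h5, h6, h7, h8, h9, h10, h11, h12, h13, h14, h15, h16⟩ := hi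
  constructor <;> try simp only [Function.update_apply]
  case canTake =>
    grind [CanTake, SeenEmpty]
  case owner =>
    intro r hr
    rcases h15 r hr with ⟨h1, h2 | h2 | ⟨r', h2⟩⟩ | h1 <;>
      grind [InQueue, Granted, Schedules, Passing]
  all_goals first | assumption | grind [InQueue, Granted, SeenSelf, Schedules, Admits]

/-- The dequeuing user is granted, hence both head and owner. It removes itself and remains owner as
a releaser that has not yet looked at the new head. -/
theorem Inv.move_linDequeue (hi : Inv users s pc) (hc : pc p = dequeuing) :
    Inv users { s with q := s.q.tail } (Function.update pc p (.dequeued s.q.head?)) := by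
  obtain ⟨hhead, ho⟩ := hi.granted p (by simp [hc, Granted])
  have hg : (pc p).Granted := by simp [hc, Granted]
  have hadm : s.st p ≠ .scheduled := by simpa [hc, Admits] using hi.admits p
  obtain ⟨q, hqq⟩ := List.head?_eq_some_iff.1 hhead
  have hnd := hi.nodup
  rw [hqq, List.nodup_cons] at hnd
  have hmem : ∀ r, r ∈ s.q ↔ r = p ∨ r ∈ q := by simp [hqq]
  have hh : ∀ p, q.head? = some p → p ∈ q := fun _ => List.mem_of_mem_head?
  rw [hhead, show s.q.tail = q by simp [hqq]]
  obtain ⟨h1, h2, h3, h4, h5, h6, h7, h8, h9, h10, h11, h12, h13, h14, h15, h16⟩ := hi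
  have h0 : ∀ p h, pc p = .schedulingWaiter h → (pc p).Schedules h := by grind [Schedules]
  constructor <;> try simp only [Function.update_apply]
  all_goals first
    | exact hnd.2
    | grind [InQueue, Granted, SeenSelf, Schedules, Admits, Passing, SeenEmpty]

theorem Inv.move (hi : Inv users s pc) (hp : p ∈ users) (hm : Move p s c l s' c') (hc : pc p = c) :
    Inv users s' (Function.update pc p c') := by
  have hadm := hi.admits p
  rw [hc] at hadm
  cases hm
  case linEnqueue => exact hi.move_linEnqueue hp hc
  case linDequeue => exact hi.move_linDequeue hc
  case casNull ho => exact hi.move_take hp (by simp [hc, SeenSelf]) (by simp [ho])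
  case casNullAgain ho => exact hi.move_take hp (by simp [hc, SeenSelf]) (by simp [ho])
  case storeOwner =>
    exact hi.move_take hp (by simp [hc, SeenSelf]) (by simp [hi.storeOwner p hc])
  case casFrom o ho =>
    exact hi.move_take hp (by simp [hc, SeenSelf]) (ho ▸ (hi.casFrom p o hc).2.1)
  case casToNull ho => exact hi.move_casToNull hp hc ho
  case casTo h ho => exact hi.move_casTo hp hc ho
  case schedule h _ => exact hi.move_schedule hp (by simp [hc, Schedules])
  case scheduleWaiter h _ => exact hi.move_schedule hp (by simp [hc, Schedules])
  case scheduleWaiterFail h hst =>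
    -- This move cannot occur: the target is in `yielding` and not SCHEDULED, hence WAITING.
    have := hi.schedules p h (by simp [hc, Schedules])
    have := hi.admits h
    rw [hi.schedulingWaiter p h hc] at this
    simp_all [Admits]
  case engage =>
    -- Storing ENGAGING must not erase a notification; only the head of the queue is ever SCHEDULED,
    -- and `p` is not yet queued.
    have : s.st p ≠ .scheduled := fun h =>
      absurd ((hi.mem_queue p).1 (List.mem_of_mem_head? (hi.scheduled p h).1)) (by simp [hc, InQueue])
    apply hi.move_local hp hc <;>
    simp_all [InQueue, Granted, SeenSelf, CanTake, Passing, SeenEmpty, Schedules, Admits]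
  case wait | reactivate | activate =>
    apply hi.move_local hp hc <;>
    simp_all [InQueue, Granted, SeenSelf, CanTake, Passing, SeenEmpty, Schedules, Admits]
  case linPeekNext =>
    apply hi.move_control hp hc <;> cases s.q.head? <;>
    simp_all [InQueue, Granted, SeenSelf, CanTake, Passing, SeenEmpty, Schedules, Admits]
  case casFromFail o ho =>
    have := hi.casFrom p o hc
    apply hi.move_control hp hc <;>
    grind [InQueue, Granted, SeenSelf, CanTake, Passing, SeenEmpty, Schedules, Admits]
  case casNullAgainFail ho =>
    have := hi.casNullAgain p hc
    apply hi.move_control hp hc <;>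
    simp_all [InQueue, Granted, SeenSelf, CanTake, Passing, SeenEmpty, Schedules, Admits]
  case scheduleFail h ho =>
    obtain ⟨hhead, -, hg, hst⟩ := hi.schedules p h (by simp [hc, Schedules])
    have := ((hi.mem_queue h).1 (List.mem_of_mem_head? hhead)).admits_cases hg (hi.admits h) hst
    apply hi.move_control hp hc <;>
    simp_all [InQueue, Granted, SeenSelf, CanTake, Passing, SeenEmpty, Schedules, Admits]
  all_goals
    apply hi.move_control hp hc <;>
    simp_all [InQueue, Granted, SeenSelf, CanTake, Passing, SeenEmpty, Schedules, Admits]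
end ClaimRelease

/-! ### The specification as a transition system -/

namespace ClaimRelease
open CSP
variable {P : Type}

/-- The control states of a user of the specification. -/
inductive SpecControl : Type
  | idle
  | pending
  | locked
  | holding
  | releasing
  | released

namespace SpecControl

/-- The next control state. -/
def next : SpecControl → SpecControl
  | idle => pending
  | pending => locked
  | locked => holding
  | holding => releasing
  | releasing => released
  | released => idle

/-- The next event of the user `p`. -/
def event (p : P) : SpecControl → Event P
  | idle => .beginClaim p
  | pending => .linClaim p
  | locked => .endClaim p
  | holding => .beginRelease p
  | releasing => .linRelease p
  | released => .endRelease p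

/-- The residual process of a user of the specification. -/
def term (p : P) : SpecControl → Term P
  | idle => .call (.specUser p)
  | pending => Event.linClaim p ⟿ Event.endClaim p ⟿
      Event.beginRelease p ⟿ Event.linRelease p ⟿ Event.endRelease p ⟿ .call (.specUser p)
  | locked => Event.endClaim p ⟿
      Event.beginRelease p ⟿ Event.linRelease p ⟿ Event.endRelease p ⟿ .call (.specUser p)
  | holding =>
      Event.beginRelease p ⟿ Event.linRelease p ⟿ Event.endRelease p ⟿ .call (.specUser p)
  | releasing => Event.linRelease p ⟿ Event.endRelease p ⟿ .call (.specUser p)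
  | released => Event.endRelease p ⟿ .call (.specUser p)

end SpecControl

/-- `SpecMove p o k l o'`: with the mutex owned by `o`, the user `p` in control state `k` of the
specification can perform `l`, after which the mutex is owned by `o'`. -/
inductive SpecMove (p : P) : Option P → SpecControl → Label (Event P) → Option P → Prop
  | beginClaim (o) : SpecMove p o .idle (.vis (.ev (.beginClaim p))) o
  | linClaim : SpecMove p none .pending .tau (some p)
  | endClaim : SpecMove p (some p) .locked (.vis (.ev (.endClaim p))) (some p)
  | beginRelease : SpecMove p (some p) .holding (.vis (.ev (.beginRelease p))) (some p)
  | linRelease : SpecMove p (some p) .releasing .tau none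
  | endRelease (o) : SpecMove p o .released (.vis (.ev (.endRelease p))) o

section Spec

variable [DecidableEq P] {users : Finset P} {max : ℕ} {o o' : Option P} {ss : P → SpecControl}
  {p : P} {k : SpecControl} {l : Label (Event P)} {T : Term P}

/-- The specification. -/
def specTerm (users : Finset P) (o : Option P) (ss : P → SpecControl) : Term P :=
  .hide (.par alphaSpec (.interleave fun u : users => (ss u.1).term u.1)
    (.call (.mutexSpec o))) linEvents

theorem SpecControl.step_iff :
    Step (definitions users max) (k.term p) l T ↔
      l = .vis (.ev (k.event p)) ∧ T = k.next.term p := by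
  cases k <;> simp [SpecControl.term, SpecControl.event, SpecControl.next, step_call_iff,
    definitions, specUserBody]

theorem SpecControl.term_noTick : NoTick (definitions users max) (k.term p) :=
  ⟨by cases k <;> nofun, fun T h => by simp [SpecControl.step_iff] at h⟩

omit [DecidableEq P] in
theorem SpecControl.event_mem : k.event p ∈ alphaSpec (P := P) := by
  cases k <;> simp [alphaSpec, SpecControl.event]

theorem specUsers_event [Nonempty users]
    (h : Step (definitions users max) (.interleave fun u : users => (ss u.1).term u.1) l T) :
    ∃ e ∈ alphaSpec, l = .vis (.ev e) := by
  obtain ⟨u, T', h, -⟩ := (step_interleave_iff fun _ => SpecControl.term_noTick).1 h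
  exact ⟨_, SpecControl.event_mem, (SpecControl.step_iff.1 h).1⟩

theorem mutexSpec_event (h : Step (definitions users max) (.call (.mutexSpec o)) l T) :
    ∃ e ∈ alphaSpec, l = .vis (.ev e) := by
  cases l with
  | tau =>
    cases o <;> simp [step_call_iff, definitions, mutexSpecBody, whenOwned, Proc.guarded,
      -step_extChoice_iff, step_extChoice_tau_iff] at h
  | vis a =>
    cases o <;> simp [step_call_iff, definitions, mutexSpecBody, whenOwned, Proc.guarded,
      -step_extChoice_iff, step_extChoice_vis_iff] at h <;>
    grind [alphaSpec]

/-- Membership in `users` matters for `linClaim`, whose input in the mutex ranges over the users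
only. -/
theorem mutexSpec_step_iff (hp : p ∈ users) :
    Step (definitions users max) (.call (.mutexSpec o)) (.vis (.ev (k.event p))) T ↔
      ∃ l o', SpecMove p o k l o' ∧ T = .call (.mutexSpec o') := by
  constructor
  · intro h
    cases k <;> cases o <;> simp [step_call_iff, definitions, mutexSpecBody, whenOwned,
      Proc.guarded, SpecControl.event, -step_extChoice_iff, step_extChoice_vis_iff] at h
    case locked.some | holding.some | releasing.some =>
      obtain ⟨rfl, rfl⟩ := h
      exact ⟨_, _, by constructor, rfl⟩
    case pending.none =>
      obtain ⟨-, rfl⟩ := h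
      exact ⟨_, _, .linClaim, rfl⟩
    all_goals exact ⟨_, _, by constructor, h⟩
  · rintro ⟨l, o', hm, rfl⟩
    cases hm <;> (try cases o) <;> simp [step_call_iff, definitions, mutexSpecBody, whenOwned,
      Proc.guarded, SpecControl.event, hp, -step_extChoice_iff, step_extChoice_vis_iff]

omit [DecidableEq P] in
theorem SpecMove.label (h : SpecMove p o k l o') :
    (k.event p ∉ linEvents (P := P) ∧ l = .vis (.ev (k.event p))) ∨
      (k.event p ∈ linEvents (P := P) ∧ l = .tau) := by
  cases h <;> simp [linEvents, SpecControl.event]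

/-- The specification is made up of the moves of the users. -/
theorem specTerm_step [Nonempty users]
    (h : Step (definitions users max) (specTerm users o ss) l T) :
    ∃ p ∈ users, ∃ o', SpecMove p o (ss p) l o' ∧
      T = specTerm users o' (Function.update ss p (ss p).next) := by
  obtain ⟨e, -, hl, _, _, hu, hm, rfl⟩ :=
    (step_hide_sync_iff specUsers_event nofun mutexSpec_event nofun).1 h
  obtain ⟨u, T', huT, rfl⟩ := (step_interleave_iff fun _ => SpecControl.term_noTick).1 hu
  obtain ⟨⟨⟩, rfl⟩ := SpecControl.step_iff.1 huT
  obtain ⟨l', o', hmv, rfl⟩ := (mutexSpec_step_iff u.2).1 hm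
  -- Both labels are determined by whether the event is hidden.
  obtain rfl : l' = l := by
    rcases hmv.label with ⟨h1, rfl⟩ | ⟨h1, rfl⟩ <;> rcases hl with ⟨h2, rfl⟩ | ⟨h2, rfl⟩ <;>
      first | rfl | exact absurd h1 h2 | exact absurd h2 h1
  refine ⟨u, u.2, o', hmv, ?_⟩
  rw [specTerm, update_val (fun p (k : SpecControl) => k.term p)]

theorem SpecMove.specTerm_step (hp : p ∈ users) (h : SpecMove p o (ss p) l o') :
    Step (definitions users max) (specTerm users o ss) l
      (specTerm users o' (Function.update ss p (ss p).next)) := by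
  have : Nonempty users := ⟨⟨p, hp⟩⟩
  refine (step_hide_sync_iff specUsers_event nofun mutexSpec_event nofun).2
    ⟨(ss p).event p, SpecControl.event_mem, h.label, _, _,
      (step_interleave_iff fun _ => SpecControl.term_noTick).2
        ⟨⟨p, hp⟩, _, SpecControl.step_iff.2 ⟨rfl, rfl⟩, rfl⟩,
      (mutexSpec_step_iff hp).2 ⟨l, o', h, rfl⟩, ?_⟩
  rw [specTerm, ← update_val (fun p (k : SpecControl) => k.term p) ss ⟨p, hp⟩]

/-- A bound on the number of internal actions that a user can still perform before a visible
action. -/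
def SpecControl.rank : SpecControl → ℕ
  | pending | releasing => 1
  | _ => 0

/-- Each internal move changes the control state of one user only, so a local decrease of rank is a
global one. -/
theorem sum_update_lt {α : Type} {f : P → α} {a : α} {g : α → ℕ} (hp : p ∈ users)
    (h : g a < g (f p)) :
    ∑ q ∈ users, g (Function.update f p a q) < ∑ q ∈ users, g (f q) := by
  refine Finset.sum_lt_sum (fun q _ => ?_) ⟨p, hp, by simpa using h⟩
  by_cases hq : q = p
  · subst hq; simpa using h.le
  · simp [hq]

/-- After a hidden claim or release the same user must perform a visible event before its next
hidden one. -/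
theorem divergences_spec (hu : users.Nonempty) :
    divergences (definitions users max) (spec users) = ∅ := by
  have := hu.to_subtype
  refine divergences_eq_empty (n := ∑ p ∈ users, SpecControl.rank .idle)
    (fun n Q => ∃ o ss, Q = specTerm users o ss ∧ n = ∑ p ∈ users, (ss p).rank)
    ⟨none, fun _ => .idle, rfl, rfl⟩ ?_
  rintro _ _ l Q' ⟨o, ss, rfl, rfl⟩ h
  obtain ⟨p, hp, o', hm, rfl⟩ := ClaimRelease.specTerm_step h
  refine ⟨_, ⟨o', _, rfl, rfl⟩, ?_⟩
  rintro rfl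
  refine sum_update_lt (f := ss) hp ?_
  generalize ss p = k at hm ⊢
  cases hm <;> simp [SpecControl.rank, SpecControl.next]

end Spec
end ClaimRelease

/-! ### Ranks, and the abstraction to the specification -/

namespace ClaimRelease
open CSP Control
variable {P : Type}

/-- A bound on the number of internal actions that a user can still perform before a visible
action. -/
def Control.rank : Control P → ℕ
  | idle | toEndClaim | holding | toEndRelease => 0
  | claimEnded | releaseEnded | toActivate | resumed | scheduleDone | casToNull => 1
  | resuming | schedulingWaiter _ => 2
  | yielding | scheduling _ => 3
  | toWait | casTo _ => 4
  | casNullAgain | peekedNext _ => 5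
  | casFrom _ | storeOwner | peekingNext => 6
  | loadOwner | toPeekNext => 7
  | casNull | dequeued _ => 8
  | peeked _ | dequeuing => 9
  | peeking | toDequeue => 10
  | toPeek => 11
  | enqueued => 12
  | enqueuing => 13
  | engaged => 14
  | begun => 15

/-- The control state of a user of the specification that corresponds to the control state of a user
of the implementation, given whether it is at the head of the queue. -/
def Control.spec (atHead : Bool) : Control P → SpecControl
  | idle | releaseEnded => .idle
  | begun | engaged | enqueuing => .pending
  | enqueued | toPeek | peeking | peeked _ | casNull | loadOwner | storeOwner | casFrom _
  | casNullAgain | toWait | yielding | resuming | resumed | toActivate | toEndClaim =>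
      bif atHead then .locked else .pending
  | claimEnded | holding => .holding
  | toDequeue | dequeuing => .releasing
  | dequeued _ | toPeekNext | peekingNext | peekedNext _ | casToNull | casTo _ | scheduling _
  | schedulingWaiter _ | scheduleDone | toEndRelease => .released

variable [DecidableEq P] {users : Finset P} {max : ℕ} {s s' : Shared P} {pc : P → Control P}
  {l : Label (Event P)} {p : P} {c c' : Control P} {t : List (Obs (Event P))} {Q : Term P}

/-- The protocol never retries in a loop: a failed CAS always leads to a later control state. -/
theorem Move.rank_lt (h : Move p s c .tau s' c') : c'.rank < c.rank := by
  cases h <;> simp [Control.rank]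

-- The queue is duplicate-free and contains only users, which bounds it independently of the
-- capacity.
omit [DecidableEq P] in
theorem Inv.length_le (hi : Inv users s pc) : s.q.length ≤ users.card := by
  classical
  rw [← List.toFinset_card_of_nodup hi.nodup]
  refine Finset.card_le_card fun p hp => ?_
  by_contra hn
  have := (hi.mem_queue p).1 (List.mem_toFinset.1 hp)
  simp [hi.idle_of_notMem p hn, InQueue] at this

theorem divergences_impl (hu : users.Nonempty) :
    divergences (definitions users max) (impl users) = ∅ := by
  have := hu.to_subtype
  refine divergences_eq_empty (n := ∑ p ∈ users, Control.rank (idle : Control P))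
    (fun n Q => ∃ s pc, Q = implTerm users s pc ∧ n = ∑ p ∈ users, (pc p).rank)
    ⟨Shared.init, fun _ => idle, rfl, rfl⟩ ?_
  rintro _ _ l Q' ⟨s, pc, rfl, rfl⟩ h
  obtain ⟨p, hp, s', c', hm, rfl⟩ := ClaimRelease.implTerm_step h
  refine ⟨_, ⟨s', _, rfl, rfl⟩, ?_⟩
  rintro rfl
  exact sum_update_lt (f := pc) hp hm.rank_lt

/-- The states of the users of the specification that correspond to a state of the
implementation. -/
def specState (s : Shared P) (pc : P → Control P) (p : P) : SpecControl :=
  (pc p).spec (decide (s.q.head? = some p))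

theorem specState_update (hq : s'.q = s.q) : specState s' (Function.update pc p c') =
    Function.update (specState s pc) p (c'.spec (decide (s.q.head? = some p))) := by
  unfold specState
  rw [hq]
  exact (update_dependent (fun p (c : Control P) => c.spec (decide (s.q.head? = some p))) pc p
    c').symm

/-- The state of the specification that corresponds to a state of the implementation. -/
def specOf (users : Finset P) (s : Shared P) (pc : P → Control P) : Term P :=
  specTerm users s.q.head? (specState s pc)

/-- Moves of this kind are stuttering steps: the specification stands still. -/
theorem specOf_update (hq : s'.q = s.q)
    (hk : ∀ b, c'.spec b = (pc p).spec b) :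
    specOf users s' (Function.update pc p c') = specOf users s pc := by
  rw [specOf, specState_update hq, hk, hq, specOf]
  congr
  exact Function.update_eq_self p (specState s pc)

theorem specOf_step (hp : p ∈ users) (hq : s'.q = s.q)
    (hm : SpecMove p s.q.head? (specState s pc p) l s.q.head?)
    (hk : c'.spec (decide (s.q.head? = some p)) = (specState s pc p).next) :
    Step (definitions users max) (specOf users s pc) l
      (specOf users s' (Function.update pc p c')) := by
  rw [specOf, specOf, specState_update hq, hk, hq]
  exact hm.specTerm_step hp

/-- The specification simulates the moves of the implementation. -/
theorem Move.specOf_runs (hi : Inv users s pc) (hp : p ∈ users)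
    (hm : Move p s (pc p) l s' c') :
    Runs (definitions users max) (specOf users s pc) l.trace
      (specOf users s' (Function.update pc p c')) := by
  have hhead := hi.granted p
  generalize hc : pc p = c at hm
  have one : ∀ {l T}, Step (definitions users max) (specOf users s pc) l T →
      Runs (definitions users max) (specOf users s pc) l.trace T := by
    intro l T h
    simpa using Runs.step h (.nil T)
  have nil : ∀ {S T : Term P}, T = S → Runs (definitions users max) S [] T := by
    rintro S T rfl
    exact .nil _
  cases hm
  case beginClaim =>
    refine one (specOf_step hp rfl ?_ ?_)
    · simpa [specState, hc, Control.spec] using SpecMove.beginClaim (p := p) _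
    · simp [specState, hc, Control.spec, SpecControl.next]
  case endClaim =>
    replace hhead := (hhead (by simp [hc, Granted])).1
    refine one (specOf_step hp rfl ?_ ?_)
    · simpa [specState, hc, Control.spec, hhead] using SpecMove.endClaim (p := p)
    · simp [specState, hc, Control.spec, SpecControl.next, hhead]
  case beginRelease =>
    replace hhead := (hhead (by simp [hc, Granted])).1
    refine one (specOf_step hp rfl ?_ ?_)
    · simpa [specState, hc, Control.spec, hhead] using SpecMove.beginRelease (p := p)
    · simp [specState, hc, Control.spec, SpecControl.next]
  case endRelease =>
    refine one (specOf_step hp rfl ?_ ?_)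
    · simpa [specState, hc, Control.spec] using SpecMove.endRelease (p := p) _
    · simp [specState, hc, Control.spec, SpecControl.next]
  -- If the queue was empty, the claim takes effect here; otherwise the user stays pending behind
  -- the head.
  case linEnqueue =>
    have hpn : p ∉ s.q := by simp [hi.mem_queue, hc, InQueue]
    cases hq : s.q with
    | nil =>
      have h1 : SpecMove p none (specState s pc p) .tau (some p) := by
        simpa [specState, hc, Control.spec, hq] using SpecMove.linClaim (p := p)
      have h2 := h1.specTerm_step (max := max) hp
      refine .tau (by simpa [specOf, hq] using h2) (nil ?_)
      rw [specOf]
      congr 1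
      funext r
      by_cases hr : r = p
      · subst hr; simp [specState, hc, Control.spec, SpecControl.next]
      · simp [specState, hq, hr, Ne.symm hr]
    | cons h q =>
      refine nil ?_
      rw [specOf, specOf]
      congr 1
      · simp [hq]
      · funext r
        by_cases hr : r = p
        · subst hr
          have : h ≠ r := by rintro rfl; simp [hq] at hpn
          simp [specState, hc, Control.spec, this]
        · simp [specState, hq, hr]
  case linDequeue =>
    replace hhead := (hhead (by simp [hc, Granted])).1
    have hnd := hi.nodup
    obtain ⟨q, hq⟩ := List.head?_eq_some_iff.1 hhead
    have h1 : SpecMove p s.q.head? (specState s pc p) .tau none := by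
      simpa [specState, hc, Control.spec, hhead] using SpecMove.linRelease (p := p)
    have h2 := h1.specTerm_step (max := max) hp
    refine .tau h2 ?_
    have hnext : (specState s pc p).next = .released := by
      simp [specState, hc, Control.spec, SpecControl.next]
    rw [hnext]
    -- If nobody is behind the releaser, the mutex becomes free. Otherwise the release is followed
    -- at once by the claim of the new head.
    cases q with
    | nil =>
      refine nil ?_
      rw [specOf]
      congr 1
      · simp [hq]
      · funext r
        by_cases hr : r = p
        · subst hr; simp [specState, Control.spec]
        · simp [specState, hq, hr, Ne.symm hr]
    | cons h q =>
      have hhp : h ≠ p := by rintro rfl; simp [hq] at hnd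
      have hh := (hi.mem_queue h).1 (by simp [hq])
      have hg : ¬ (pc h).Granted := fun hg =>
        hhp (by simpa [hhead, eq_comm] using (hi.granted h hg).1)
      -- The new head was queued but not granted, so its abstract state depends only on its being at
      -- the head.
      obtain ⟨hlocked, hpend⟩ : (pc h).spec true = .locked ∧ (pc h).spec false = .pending := by
        generalize pc h = c at hh hg
        cases c <;> simp_all [InQueue, Granted, Control.spec]
      have h3 : SpecMove h none
          (Function.update (specState s pc) p .released h) .tau (some h) := by
        simpa [specState, hhead, hhp, hpend, Ne.symm hhp] using SpecMove.linClaim (p := h)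
      have hhu : h ∈ users := by
        by_contra hn
        simp [hi.idle_of_notMem h hn, InQueue] at hh
      refine .tau (h3.specTerm_step hhu) ?_
      refine nil ?_
      rw [specOf]
      congr 1
      · simp [hq]
      · funext r
        by_cases hr : r = p
        · subst hr; simp [specState, Control.spec, Ne.symm hhp]
        by_cases hrh : r = h
        · subst hrh
          simp [specState, hq, hr, Ne.symm hr, hpend, hlocked, SpecControl.next]
        · simp [specState, hq, hr, hrh, Ne.symm hr, Ne.symm hrh]
  all_goals
    rw [specOf_update rfl (by simp [hc, Control.spec])]
    exact .nil _

end ClaimRelease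

/-! ### Stable states and the inclusions of failures -/

namespace ClaimRelease
open CSP Control
variable {P : Type} [DecidableEq P] {users : Finset P} {max : ℕ} {s s' : Shared P}
  {pc : P → Control P} {l : Label (Event P)} {p : P} {c c' : Control P}
  {t : List (Obs (Event P))} {Q : Term P} {o o' : Option P} {ss : P → SpecControl} {k : SpecControl}

/-- The control states in which a user may be unable to perform an internal action. -/
def Control.Quiescent : Control P → Prop
  | idle | yielding | toEndClaim | holding | toEndRelease => True
  | _ => False

omit [DecidableEq P] in
theorem SpecMove.not_tick : ¬ SpecMove p o k (.vis .tick) o' := nofun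

theorem Move.not_tick : ¬ Move p s c (.vis .tick) s' c' := nofun

/-- The invariant is needed for one state: a release accepts only its own identifier from the
dequeue, and would otherwise be stuck in `dequeued`. -/
theorem Inv.exists_move (hi : Inv users s pc) (hc : ¬ (pc p).Quiescent) :
    ∃ s' c', Move p s (pc p) .tau s' c' := by
  have hd := hi.dequeued p
  generalize pc p = c at hc hd
  cases c <;> simp only [Quiescent, not_true_eq_false, not_false_eq_true] at hc
  case peeked v =>
    by_cases hv : v = some p
    · subst hv; exact ⟨_, _, .peekedSelf s⟩
    · exact ⟨_, _, .peekedOther s v hv⟩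
  case casNull =>
    by_cases ho : s.owner = none
    · exact ⟨_, _, .casNull s ho⟩
    · exact ⟨_, _, .casNullFail s ho⟩
  case casNullAgain =>
    by_cases ho : s.owner = none
    · exact ⟨_, _, .casNullAgain s ho⟩
    · exact ⟨_, _, .casNullAgainFail s ho⟩
  case loadOwner =>
    by_cases ho : s.owner = none
    · exact ⟨_, _, .loadNull s ho⟩
    by_cases hp : s.owner = some p
    · exact ⟨_, _, .loadSelf s hp⟩
    · exact ⟨_, _, .loadOther s ho hp⟩
  case casFrom o =>
    by_cases ho : o = s.owner
    · exact ⟨_, _, .casFrom s o ho⟩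
    · exact ⟨_, _, .casFromFail s o ho⟩
  case toWait =>
    by_cases hw : s.st p = .engaging
    · exact ⟨_, _, .wait s hw⟩
    · exact ⟨_, _, .waitFail s hw⟩
  case dequeued v =>
    obtain rfl := hd v rfl
    exact ⟨_, _, .dequeued s⟩
  case peekedNext v =>
    cases v with
    | none => exact ⟨_, _, .nextNull s⟩
    | some h => exact ⟨_, _, .next s h⟩
  case casToNull =>
    by_cases ho : s.owner = some p
    · exact ⟨_, _, .casToNull s ho⟩
    · exact ⟨_, _, .casToNullFail s ho⟩
  case casTo h =>
    by_cases ho : s.owner = some p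
    · exact ⟨_, _, .casTo s h ho⟩
    · exact ⟨_, _, .casToFail s h ho⟩
  case scheduling h =>
    by_cases hw : s.st h = .engaging
    · exact ⟨_, _, .schedule s h hw⟩
    · exact ⟨_, _, .scheduleFail s h hw⟩
  case schedulingWaiter h =>
    by_cases hw : s.st h = .waiting
    · exact ⟨_, _, .scheduleWaiter s h hw⟩
    · exact ⟨_, _, .scheduleWaiterFail s h hw⟩
  all_goals exact ⟨_, _, by constructor⟩

theorem Inv.runs (hi : Inv users s pc) (hu : users.Nonempty)
    (hr : Runs (definitions users max) (implTerm users s pc) t Q) :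
    ∃ s' pc', Q = implTerm users s' pc' ∧ Inv users s' pc' ∧
      Runs (definitions users max) (specOf users s pc) t (specOf users s' pc') := by
  have := hu.to_subtype
  generalize hT : implTerm users s pc = T at hr
  induction hr generalizing s pc with
  | nil => exact ⟨s, pc, hT.symm, hi, .nil _⟩
  | tau h _ ih =>
    subst hT
    obtain ⟨p, hp, s', c', hm, rfl⟩ := ClaimRelease.implTerm_step h
    obtain ⟨s'', pc', rfl, hi', hr⟩ := ih (hi.move hp hm rfl) rfl
    exact ⟨s'', pc', rfl, hi', (hm.specOf_runs hi hp).append hr⟩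
  | vis h _ ih =>
    subst hT
    obtain ⟨p, hp, s', c', hm, rfl⟩ := ClaimRelease.implTerm_step h
    obtain ⟨s'', pc', rfl, hi', hr⟩ := ih (hi.move hp hm rfl) rfl
    exact ⟨s'', pc', rfl, hi', (hm.specOf_runs hi hp).append hr⟩

omit [DecidableEq P] in
/-- In a stable state of the implementation, the head of the queue is not blocked. -/
theorem Inv.head_of_quiescent (hi : Inv users s pc) (hq : ∀ p, (pc p).Quiescent)
    (hy : ∀ p, pc p = yielding → s.st p ≠ .scheduled) {h : P} (hh : s.q.head? = some h) :
    pc h = toEndClaim ∨ pc h = holding := by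
  have hin := (hi.mem_queue h).1 (List.mem_of_mem_head? hh)
  have hct := hi.canTake h hh
  have hno : ∀ r x, ¬ (pc r).Schedules x := fun r x => by
    have := hq r
    generalize pc r = c at this
    cases c <;> simp_all [Quiescent, Schedules]
  have hnp : ∀ r x, ¬ (pc r).Passing x := fun r x => by
    have := hq r
    generalize pc r = c at this
    cases c <;> simp_all [Quiescent, Passing]
  have hqh := hq h
  -- Without an owner, `canTake` puts the head in a state with an internal move. With an owner and
  -- no pending hand-over, the owner is the head and has been granted or scheduled; a scheduled user
  -- in `yielding` could resume.
  rcases ho : s.owner with _ | r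
  · have := hct (.inl ho)
    generalize pc h = c at this hqh
    cases c <;> simp_all [Quiescent, CanTake]
  · rcases hi.owner r ho with ⟨hr, hr'⟩ | hr
    · obtain rfl : r = h := by simpa [hh, eq_comm] using hr
      have hyr := hy r
      have hadm := hi.admits r
      simp only [hno, exists_false, or_false] at hr'
      generalize pc r = c at hqh hin hr' hyr hadm
      cases c <;> simp_all [Quiescent, InQueue, Granted]
    · exact absurd hr (hnp _ _)

/-- A stable implementation state has only quiescent users, and its head is ready for a visible
event. The abstract state is then stable, and each event it offers is offered by the implementation.
-/
theorem Inv.refuses (hi : Inv users s pc) (hu : users.Nonempty) (hmax : users.card ≤ max)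
    {X : Set (Obs (Event P))} (h : Refuses (definitions users max) (implTerm users s pc) X) :
    Refuses (definitions users max) (specOf users s pc) X := by
  have := hu.to_subtype
  have hlen := hi.length_le.trans hmax
  rcases h with ⟨hst, hX⟩ | ⟨⟨T, h⟩, -⟩
  swap
  · obtain ⟨p, hp, s', c', hm, -⟩ := ClaimRelease.implTerm_step h
    exact absurd hm Move.not_tick
  have hq : ∀ p, (pc p).Quiescent := fun p => by
    by_cases hp : p ∈ users
    · by_contra hq
      obtain ⟨s', c', hm⟩ := hi.exists_move hq
      exact hst _ (hm.implTerm_step hp hlen)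
    · simp [hi.idle_of_notMem p hp, Quiescent]
  have hy : ∀ p, pc p = yielding → s.st p ≠ .scheduled := fun p hpc h => by
    have hp : p ∈ users := by
      by_contra hn
      simp [hi.idle_of_notMem p hn] at hpc
    exact hst _ (Move.implTerm_step (c' := resuming) hp (by rw [hpc]; exact .resume s h) hlen)
  have hhead := fun h => hi.head_of_quiescent hq hy (h := h)
  refine .inl ⟨fun T h => ?_, fun a ha T h => ?_⟩
  · obtain ⟨p, hp, o', hm, -⟩ := ClaimRelease.specTerm_step h
    have hqp := hq p
    have hin := hi.mem_queue p
    generalize hk : specState s pc p = k at hm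
    generalize ho : s.q.head? = o at hm
    cases hm
    -- A free mutex means an empty queue, but a quiescent user with a pending claim has already been
    -- enqueued.
    case linClaim =>
      have : s.q = [] := by simpa using ho
      simp only [specState, this] at hk
      simp only [this, List.not_mem_nil, false_iff] at hin
      generalize pc p = c at hk hin hqp
      cases c <;> simp_all [Control.spec, InQueue, Quiescent]
    -- The abstract owner is the head, which in a stable state is at `toEndClaim` or `holding`, not
    -- releasing.
    case linRelease =>
      rcases hhead p ho with h | h <;> simp [specState, h, Control.spec, ho] at hk
  · obtain ⟨p, hp, o', hm, -⟩ := ClaimRelease.specTerm_step h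
    have hqp := hq p
    have hhp := hhead p
    suffices ∃ s' c', Move p s (pc p) (.vis a) s' c' by
      obtain ⟨s', c', hm⟩ := this
      exact hX a ha _ (hm.implTerm_step hp hlen)
    generalize hk : specState s pc p = k at hm
    generalize ho : s.q.head? = o at hm
    rw [specState] at hk
    cases hm
    case endClaim =>
      rcases hhp ho with h | h
      · exact ⟨_, _, by rw [h]; exact .endClaim s⟩
      · simp [h, Control.spec] at hk
    case beginRelease =>
      rcases hhp ho with h | h
      · simp [h, Control.spec, ho] at hk
      · exact ⟨_, _, by rw [h]; exact .beginRelease s⟩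
    case beginClaim =>
      generalize pc p = c at hk hqp
      cases c <;> simp only [Control.spec, Quiescent, reduceCtorEq] at hk hqp
      · exact ⟨_, _, .beginClaim s⟩
      all_goals cases h : decide (s.q.head? = some p) <;> simp [h] at hk
    case endRelease =>
      generalize pc p = c at hk hqp
      cases c <;> simp only [Control.spec, Quiescent, reduceCtorEq] at hk hqp
      case toEndRelease => exact ⟨_, _, .endRelease s⟩
      all_goals cases h : decide (s.q.head? = some p) <;> simp [h] at hk

theorem failures_impl_subset (hu : users.Nonempty) (hmax : users.card ≤ max) :
    failures (definitions users max) (impl users) ⊆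
      failures (definitions users max) (spec users) := by
  rintro ⟨t, X⟩ ⟨Q, hr, hX⟩
  obtain ⟨s, pc, rfl, hi, hr'⟩ := Inv.init.runs hu hr
  exact ⟨_, hr', hi.refuses hu hmax hX⟩

/-! ### The implementation simulates the specification -/

/-- A sequence of moves of the user `p`. -/
inductive Moves (p : P) :
    Shared P → Control P → List (Obs (Event P)) → Shared P → Control P → Prop
  | nil (s : Shared P) (c : Control P) : Moves p s c [] s c
  | tau {s s' s'' : Shared P} {c c' c'' : Control P} {t : List (Obs (Event P))} :
      Move p s c .tau s' c' → Moves p s' c' t s'' c'' → Moves p s c t s'' c''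
  | vis {s s' s'' : Shared P} {c c' c'' : Control P} {t : List (Obs (Event P))}
      {a : Obs (Event P)} :
      Move p s c (.vis a) s' c' → Moves p s' c' t s'' c'' → Moves p s c (a :: t) s'' c''

theorem Moves.runs (hmax : users.card ≤ max) (hp : p ∈ users) (hm : Moves p s c t s' c')
    (hi : Inv users s pc) (hc : pc p = c) : Inv users s' (Function.update pc p c') ∧
      Runs (definitions users max) (implTerm users s pc) t
        (implTerm users s' (Function.update pc p c')) := by
  induction hm generalizing pc with
  | nil s c =>
    subst hc
    rw [Function.update_eq_self]
    exact ⟨hi, .nil _⟩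
  | tau hm _ ih =>
    obtain ⟨h1, h2⟩ := ih (hi.move hp hm hc) (by simp)
    rw [Function.update_idem] at h1 h2
    exact ⟨h1, .tau ((hc ▸ hm).implTerm_step hp (hi.length_le.trans hmax)) h2⟩
  | vis hm _ ih =>
    obtain ⟨h1, h2⟩ := ih (hi.move hp hm hc) (by simp)
    rw [Function.update_idem] at h1 h2
    exact ⟨h1, .vis ((hc ▸ hm).implTerm_step hp (hi.length_le.trans hmax)) h2⟩

/-- The control state of a user of the implementation that corresponds to the control state of a
user of the specification when all operations are performed without interference. -/
def SpecControl.impl : SpecControl → Control P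
  | idle => .idle
  | pending => .begun
  | locked => .toEndClaim
  | holding => .holding
  | releasing => .toDequeue
  | released => .toEndRelease

/-- The shared data of the implementation when all operations are performed without
interference. -/
def Shared.sequential (o : Option P) : Shared P := ⟨o, fun _ => .active, o.toList⟩

/-- An undisturbed claim finds itself at the head and OWNER empty; an undisturbed release finds the
queue empty and resets OWNER. Hence the scheduling branches are never entered. -/
theorem SpecMove.moves (h : SpecMove p o k l o') :
    Moves p (Shared.sequential o) k.impl l.trace (Shared.sequential o') k.next.impl := by
  cases h with
  | beginClaim => exact .vis (.beginClaim _) (.nil _ _)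
  | linClaim =>
    refine .tau (.engage _) <| .tau (.enqueue _) <| .tau (.linEnqueue _) <|
      .tau (.endEnqueue _) <| .tau (.peek _) <| .tau (.linPeek _) <| .tau (.peekedSelf _) <|
      .tau (.casNull _ rfl) <| .tau (.activate _) ?_
    -- Storing ENGAGING and then ACTIVE restores the initial values.
    suffices h : Function.update (Function.update (fun _ => UState.active) p .engaging) p .active =
        fun _ => .active by
      dsimp only [Shared.sequential]
      rw [h]
      exact .nil _ _
    rw [Function.update_idem]
    exact Function.update_eq_self p _
  | endClaim => exact .vis (.endClaim _) <| .tau (.claimed _) <| .nil _ _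
  | beginRelease => exact .vis (.beginRelease _) (.nil _ _)
  | linRelease =>
    exact .tau (.dequeue _) <| .tau (.linDequeue _) <| .tau (.dequeued _) <| .tau (.peekNext _) <|
      .tau (.linPeekNext _) <| .tau (.nextNull _) <| .tau (.casToNull _ rfl) <| .nil _ _
  | endRelease => exact .vis (.endRelease _) <| .tau (.released _) <| .nil _ _

theorem spec_runs (hu : users.Nonempty) (hmax : users.card ≤ max)
    (hi : Inv users (Shared.sequential o) fun p => (ss p).impl)
    (hr : Runs (definitions users max) (specTerm users o ss) t Q) :
    ∃ o' ss', Q = specTerm users o' ss' ∧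
      Inv users (Shared.sequential o') (fun p => (ss' p).impl) ∧
      Runs (definitions users max) (implTerm users (Shared.sequential o) fun p => (ss p).impl) t
        (implTerm users (Shared.sequential o') fun p => (ss' p).impl) := by
  have := hu.to_subtype
  have step : ∀ {o ss l T}, Inv users (Shared.sequential o) (fun p => (ss p).impl) →
      Step (definitions users max) (specTerm users o ss) l T →
      ∃ o' ss', T = specTerm users o' ss' ∧
        Inv users (Shared.sequential o') (fun p => (ss' p).impl) ∧
        Runs (definitions users max) (implTerm users (Shared.sequential o) fun p => (ss p).impl)
          l.trace (implTerm users (Shared.sequential o') fun p => (ss' p).impl) := by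
    intro o ss l T hi h
    obtain ⟨p, hp, o', hm, rfl⟩ := ClaimRelease.specTerm_step h
    have := hm.moves.runs hmax hp hi rfl
    rw [update_dependent (fun _ (k : SpecControl) => k.impl) ss] at this
    exact ⟨o', _, rfl, this⟩
  generalize hT : specTerm users o ss = T at hr
  induction hr generalizing o ss with
  | nil => exact ⟨o, ss, hT.symm, hi, .nil _⟩
  | tau h _ ih =>
    subst hT
    obtain ⟨o', ss', rfl, hi', hr⟩ := step hi h
    obtain ⟨o'', ss'', rfl, hi'', hr'⟩ := ih hi' rfl
    exact ⟨o'', ss'', rfl, hi'', hr.append hr'⟩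
  | vis h _ ih =>
    subst hT
    obtain ⟨o', ss', rfl, hi', hr⟩ := step hi h
    obtain ⟨o'', ss'', rfl, hi'', hr'⟩ := ih hi' rfl
    exact ⟨o'', ss'', rfl, hi'', hr.append hr'⟩

/-- While another user has the mutex, the pending claims can proceed until they wait. -/
theorem exists_waiting {h : P} (hmax : users.card ≤ max)
    (hi : Inv users (Shared.sequential (some h)) fun p => (ss p).impl) (A : Finset P)
    (hA : ∀ p ∈ A, p ∈ users ∧ p ≠ h ∧ ss p = .pending) :
    ∃ s pc, Inv users s pc ∧ s.q.head? = some h ∧ (∀ p ∈ A, pc p = yielding ∧ s.st p = .waiting) ∧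
      (∀ p, p ∉ A → pc p = (ss p).impl) ∧
      Runs (definitions users max)
        (implTerm users (Shared.sequential (some h)) fun p => (ss p).impl) []
        (implTerm users s pc) := by
  induction A using Finset.induction_on with
  | empty => exact ⟨_, _, hi, rfl, by simp, fun _ _ => rfl, .nil _⟩
  | insert p A hpA ih =>
    obtain ⟨s, pc, hi', hq, hA', hpc, hr⟩ := ih fun p hp => hA p (Finset.mem_insert_of_mem hp)
    obtain ⟨hp, hph, hss⟩ := hA p (Finset.mem_insert_self p A)
    have hc : pc p = begun := by rw [hpc p hpA, hss]; rfl
    have hq' : (s.q ++ [p]).head? = some h := by simp [hq]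
    -- Enqueued behind `h`, the user peeks an identifier other than its own, and its CAS from
    -- ENGAGING succeeds because nobody has scheduled it.
    have hm : Moves p s begun [] { s with
        st := Function.update (Function.update s.st p .engaging) p .waiting
        q := s.q ++ [p] } yielding := by
      refine .tau (.engage _) <| .tau (.enqueue _) <| .tau (.linEnqueue _) <|
        .tau (.endEnqueue _) <| .tau (.peek _) <| .tau (.linPeek _) <|
        .tau (.peekedOther _ _ ?_) <| .tau (.wait _ ?_) <| .nil _ _
      · simpa [hq] using hph.symm
      · simp
    obtain ⟨hi'', hr'⟩ := hm.runs hmax hp hi' hc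
    refine ⟨_, _, hi'', hq', fun r hr => ?_, fun r hr => ?_, hr.append hr'⟩
    · by_cases hrp : r = p
      · subst hrp; simp
      · simpa [hrp] using hA' r ((Finset.mem_insert.1 hr).resolve_left hrp)
    · rw [Finset.mem_insert, not_or] at hr
      simpa [hr.1] using hpc r hr.2

/-- A claim pending in a stable specification state corresponds to `begun`, which has internal
moves; it must first be driven to `yielding`, where it waits and offers no events. -/
theorem failures_spec_subset (hu : users.Nonempty) (hmax : users.card ≤ max) :
    failures (definitions users max) (spec users) ⊆
      failures (definitions users max) (impl users) := by
  have := hu.to_subtype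
  rintro ⟨t, X⟩ ⟨Q, hr, hX⟩
  obtain ⟨o, ss, rfl, hi, hr'⟩ := spec_runs (o := none) (ss := fun _ => .idle) hu hmax Inv.init hr
  rcases hX with ⟨hst, hX⟩ | ⟨⟨T, h⟩, -⟩
  swap
  · obtain ⟨p, hp, o', hm, -⟩ := ClaimRelease.specTerm_step h
    exact absurd hm SpecMove.not_tick
  have hidle : ∀ p, p ∉ users → ss p = .idle := fun p hp => by
    have := hi.idle_of_notMem p hp
    generalize ss p = k at this
    cases k <;> simp_all [SpecControl.impl]
  have howner : ∀ p, ss p = .locked ∨ ss p = .holding ∨ ss p = .releasing → o = some p :=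
    fun p hp => (hi.granted p (by rcases hp with h | h | h <;> simp [h, SpecControl.impl, Granted])).2
  have hrel : ∀ p, ss p ≠ .releasing := fun p hp => by
    have hpu : p ∈ users := by
      by_contra hn
      simp [hidle p hn] at hp
    obtain rfl := howner p (by simp [hp])
    exact hst _ (SpecMove.specTerm_step (p := p) hpu (by rw [hp]; exact .linRelease))
  have hfin : ∃ s pc, Inv users s pc ∧
      (∀ p, (pc p = yielding ∧ s.st p = .waiting) ∨ (pc p = (ss p).impl ∧ ss p ≠ .pending)) ∧
      Runs (definitions users max) (implTerm users (Shared.sequential o) fun p => (ss p).impl) []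
        (implTerm users s pc) := by
    cases o with
    -- With the mutex free, a pending claim could perform its hidden `linClaim`; stability excludes
    -- it.
    | none =>
      refine ⟨_, _, hi, fun p => .inr ⟨rfl, fun hp => ?_⟩, .nil _⟩
      have hpu : p ∈ users := by
        by_contra hn
        simp [hidle p hn] at hp
      exact hst _ (SpecMove.specTerm_step (p := p) hpu (by rw [hp]; exact .linClaim))
    | some h =>
      classical
      have hh : ss h ≠ .pending := fun hh => by
        have := (hi.mem_queue h).1 (by simp [Shared.sequential])
        simp [hh, SpecControl.impl, InQueue] at this
      obtain ⟨s, pc, hi', -, hA, hpc, hr⟩ := exists_waiting hmax hi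
        (users.filter fun p => ss p = .pending) fun p hp => by
          obtain ⟨h1, h2⟩ := Finset.mem_filter.1 hp
          exact ⟨h1, by rintro rfl; exact hh h2, h2⟩
      refine ⟨s, pc, hi', fun p => ?_, hr⟩
      by_cases hp : p ∈ users.filter fun p => ss p = .pending
      · exact .inl (hA p hp)
      · refine .inr ⟨hpc p hp, fun hp' => ?_⟩
        refine hp (Finset.mem_filter.2 ⟨?_, hp'⟩)
        by_contra hn
        simp [hidle p hn] at hp'
  obtain ⟨s, pc, hi', hpc, hr''⟩ := hfin
  refine ⟨implTerm users s pc, by simpa using! Runs.append hr' hr'', .inl ⟨fun T h => ?_,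
    fun a ha T h => ?_⟩⟩
  -- Stability: a user in `yielding` with state WAITING cannot resume, and the other remaining
  -- control states have only visible moves.
  · obtain ⟨p, hp, s', c', hm, -⟩ := ClaimRelease.implTerm_step h
    have hrelp := hrel p
    rcases hpc p with ⟨hp1, hp2⟩ | ⟨hp1, hp2⟩
    · rw [hp1] at hm
      cases hm
      simp_all
    · rw [hp1] at hm
      generalize ss p = k at *
      cases k <;> simp only [SpecControl.impl, ne_eq, not_true_eq_false] at hm hp2 hrelp <;> cases hm
  -- Refusals: each visible event still offered is the next event of that user in the specification,
  -- and the mutex permits it because a user ending its claim or beginning its release is the owner.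
  · obtain ⟨p, hp, s', c', hm, -⟩ := ClaimRelease.implTerm_step h
    suffices ∃ o', SpecMove p o (ss p) (.vis a) o' by
      obtain ⟨o', hm⟩ := this
      exact hX a ha _ (hm.specTerm_step hp)
    have hop := howner p
    rcases hpc p with ⟨hp1, -⟩ | ⟨hp1, hp2⟩
    · rw [hp1] at hm
      cases hm
    · rw [hp1] at hm
      generalize ss p = k at *
      cases k <;> simp only [SpecControl.impl] at hm <;> cases hm
      · exact ⟨_, .beginClaim _⟩
      · obtain rfl := hop (by simp)
        exact ⟨_, .endClaim⟩
      · obtain rfl := hop (by simp)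
        exact ⟨_, .beginRelease⟩
      · exact ⟨_, .endRelease _⟩

end ClaimRelease

theorem mainTheorem2 (NonNullPID : Type) [Fintype NonNullPID] [DecidableEq NonNullPID]
    (users : Finset NonNullPID) (h1 : 1 ≤ users.card) (h4 : users.card ≤ 4)
    (max : ℕ) (hmax : users.card ≤ max) :
    CSP.FDRefines (ClaimRelease.definitions users max)
        (ClaimRelease.spec users) (ClaimRelease.impl users) ∧
      CSP.FDRefines (ClaimRelease.definitions users max)
        (ClaimRelease.impl users) (ClaimRelease.spec users) := by
  have hu : users.Nonempty := Finset.card_pos.1 h1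
  simp only [CSP.FDRefines, CSP.failuresBot, ClaimRelease.divergences_spec hu,
    ClaimRelease.divergences_impl hu, Set.mem_empty_iff_false, Set.ofPred_false, Set.union_empty,
    subset_refl, and_true]
  exact ⟨ClaimRelease.failures_impl_subset hu hmax, ClaimRelease.failures_spec_subset hu hmax⟩
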